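/- Let $W\subset\mathbb R^{\mathcal I}$ ($\mathcal I$ a finite set) be open; e.g. the image of a coordinate chart $\{u_i\}_{i\in\mathcal I}$ of a cotangent bundle $T^*E$. Let $\mathcal V_{loc}$ be the algebra of smooth functions of $(u,u^{(1)},\dots,u^{(k)})$, $u\in W$, $k$ finite but arbitrary, with total derivative $\partial f=\sum_{i,m}u_i^{(m+1)}\frac{\partial f}{\partial u_i^{(m)}}$. Let $\widetilde{\mathcal V}_{loc}\supset\mathcal V_{loc}$ be the analogous algebra of functions that may in addition depend smoothly on $t\in S^1=\mathbb R/\mathbb Z$, with $\partial=\partial_t+\sum_{i,m} u_i^{(m+1)}\frac{\partial}{\partial u_i^{(m)}}$, and let $\mathcal F^0=\widetilde{\mathcal V}_{loc}/\partial\widetilde{\mathcal V}_{loc}$, the class of $h$ being written $[h]=\int_{S^1}h\,dt$. Put $\frac{\delta f}{\delta u_i}=\sum_m(-\partial)^m\frac{\partial f}{\partial u_i^{(m)}}$. Let $\{u_{i\,\lambda}u_j\}=\sum_k B_{ij,k}\lambda^k\in\mathcal V_{loc}[\lambda]$ $(i,j\in\mathcal I)$ be given, corresponding to the local bracket $\{u_i(t),u_j(s)\}$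 of the coordinates (for $\{u_i(t),u_j(s)\}=B_{ij}\,\delta(t-s)$ it is just $B_{ij}$), and write $\{u_{i\,L}u_j\}_\rightarrow=\sum_k B_{ij,k}L^k$ for an operator $L$. Densities $a,b\in\widetilde{\mathcal V}_{loc}$ have the bracket $$\{[a],[b]\}=\Big[\sum_{i,j}\frac{\delta b}{\delta u_j}\,\{u_{i\,\partial}u_j\}_\rightarrow\frac{\delta a}{\delta u_i}\Big]\in\mathcal F^0 ,$$ in particular the local distributions $J_\phi(f)=[f\phi]$ ($f\in\mathcal V_{loc}$, $\phi\in C^\infty(S^1)$) have brackets $\{J_\phi(f),J_\psi(g)\}$. The $\lambda$-bracket of $f,g\in\mathcal V_{loc}$ is $$\{f_\lambda g\}=\sum_{i,j\in\mathcal I,\ m,n\ge0}\frac{\partial g}{\partial u_j^{(n)}}(\partial+\lambda)^n\{u_{i\,\partial+\lambda}u_j\}_\rightarrow(-\partial-\lambda)^m\frac{\partial f}{\partial u_i^{(m)}}\in\mathcal V_{loc}[\lambda],\qquad f_{(j)}g=\frac{d^j}{d\lambda^j}\{f_\lambda g\}\Big|_{\lambda=0}.$$ **Proposition.** There are maps $\llbracket\cdot,\cdot\rrbracket\colon\mathcal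 V_{loc}\times\mathcal V_{loc}\to\mathcal V_{loc}$ and $C_j\colon\mathcal V_{loc}\times\mathcal V_{loc}\to\mathcal V_{loc}$ $(j\ge1)$, with $C_j(f,g)\neq0$ for only finitely many $j$ for each $f,g$, such that for all $f,g\in\mathcal V_{loc}$ and $\phi,\psi\in C^\infty(S^1)$ $$\{J_\phi(f),J_\psi(g)\}=J_{\phi\psi}(\llbracket f,g\rrbracket)+\sum_{j\ge1}\int_{S^1}\psi\,(\partial_t^j\phi)\,C_j(f,g)\,dt\quad\text{in }\mathcal F^0 .$$ Moreover, any such maps satisfy, for all $f,g\in\mathcal V_{loc}$: 1. $\displaystyle\llbracket f,g\rrbracket=\{f_\lambda g\}\big|_{\lambda=0}=\sum_{i,j\in\mathcal I,\ n\ge0}\frac{\partial g}{\partial u_j^{(n)}}\,\partial^n\{u_{i\,\partial}u_j\}_\rightarrow\frac{\delta f}{\delta u_i}$; 2. $\displaystyle C_j(f,g)=\frac1{j!}\frac{d^j}{d\lambda^j}\{f_\lambda g\}\Big|_{\lambda=0}=\frac{f_{(j)}g}{j!}$ for all $j\ge1$; 3. the bilinear form $\langle f,g\rangle=\frac12\sum_{j\ge1}(-\partial)^{j-1}\big(C_j(f,g)+C_j(g,f)\big)$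 obtained from the bracket of distributions equals the one obtained from the $\lambda$-bracket, $\frac12\sum_{j\ge1}\frac{(-\partial)^{j-1}}{j!}\frac{d^j}{d\lambda^j}\big(\{f_\lambda g\}+\{g_\lambda f\}\big)\big|_{\lambda=0}$; 4. if the bracket of local functionals above is a Lie bracket (skew-symmetric and satisfying the Jacobi identity), then $(\mathcal V_{loc},\langle\cdot,\cdot\rangle,\llbracket\cdot,\cdot\rrbracket,\partial)$ is a weak Courant–Dorfman algebra: $\langle\cdot,\cdot\rangle$ is symmetric and bilinear, $\llbracket\cdot,\cdot\rrbracket$ is bilinear, and $\llbracket f,\llbracket g,h\rrbracket\rrbracket=\llbracket\llbracket f,g\rrbracket,h\rrbracket+\llbracket g,\llbracket f,h\rrbracket\rrbracket$, $\llbracket f,g\rrbracket+\llbracket g,f\rrbracket=\partial\langle f,g\rangle$, $\llbracket\partial a,f\rrbracket=0$ for all $a,f,g,h\in\mathcal V_{loc}$. So the two ways of building a weak Courant–Dorfman algebra from the local Poisson bracket agree. -/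

import Mathlib

open scoped ContDiff
open Polynomial

set_option linter.unusedSectionVars false

noncomputable section

namespace LoopPoisson

/-! ## Operations on an algebra of differential functions

`S` is a commutative algebra with a derivation `d` (the total derivative along the loop) and
derivations `pd i m` (the partial derivatives with respect to the jet coordinates `u_i^(m)`).
All infinite sums below have finitely many non-zero terms for local functions. -/

section Generic

variable {ι : Type*} [Fintype ι] {S : Type*} [CommRing S] [Algebra ℝ S]

/-- The variational (Euler-Lagrange) derivative
`δf/δu_i = ∑_m (-∂)^m (∂f/∂u_i^(m))`. -/
def varDer (d : Derivation ℝ S S) (pd : ι → ℕ → Derivation ℝ S S) (i : ι) (f : S) : S :=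
  ∑ᶠ m : ℕ, (fun x => -d x)^[m] (pd i m f)

/-- The operator obtained from the polynomial `P = ∑ P_k λ^k` by substituting the operator `L`
for `λ` and moving the powers of `L` to the right: `x ↦ ∑ P_k (L^k x)`. -/
def applyRight {M : Type*} [AddCommMonoid M] [Module S M] (P : S[X]) (L : M → M) (x : M) : M :=
  P.sum fun k a => a • L^[k] x

/-- The operator `∂ + λ` on `S[λ]`; `∂` acts on the coefficients. -/
def shiftDer (d : Derivation ℝ S S) (p : S[X]) : S[X] :=
  (p.sum fun k a => monomial k (d a)) + X * p

/-- The `λ`-bracket determined by the brackets `B i j = {u_i λ u_j}` of the coordinates: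
`∑ ∂g/∂u_j^(n) (∂+λ)^n {u_i_{∂+λ} u_j}_→ (-∂-λ)^m ∂f/∂u_i^(m)`. -/
def lambdaBr (d : Derivation ℝ S S) (pd : ι → ℕ → Derivation ℝ S S) (B : ι → ι → S[X])
    (f g : S) : S[X] :=
  ∑ i, ∑ j, ∑ᶠ n : ℕ, ∑ᶠ m : ℕ,
    C (pd j n g) * (shiftDer d)^[n]
      (applyRight (B i j) (shiftDer d) ((fun p => -shiftDer d p)^[m] (C (pd i m f))))

/-- The derivation `f ↦ ∑_{i,m} c i m * ∂f/∂u_i^(m)`. -/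
def evolutionDer (pd : ι → ℕ → Derivation ℝ S S)
    (hfin : ∀ i f, (Function.support fun m => pd i m f).Finite) (c : ι → ℕ → S) :
    Derivation ℝ S S :=
  have hs : ∀ i f, (Function.support fun m => c i m * pd i m f).Finite := fun i f =>
    (hfin i f).subset (fun m hm h0 => hm (by
      have h1 : pd i m f = 0 := h0
      simp [h1]))
  Derivation.mk'
    { toFun := fun f => ∑ i, ∑ᶠ m : ℕ, c i m * pd i m f
      map_add' := fun f g => by
        rw [← Finset.sum_add_distrib]
        refine Finset.sum_congr rfl fun i _ => ?_
        rw [← finsum_add_distrib (hs i f) (hs i g)]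
        exact finsum_congr fun m => by rw [map_add, mul_add]
      map_smul' := fun r f => by
        simp only [RingHom.id_apply]
        rw [Finset.smul_sum]
        refine Finset.sum_congr rfl fun i _ => ?_
        rw [smul_finsum' r (hs i f)]
        exact finsum_congr fun m => by rw [Derivation.map_smul, mul_smul_comm] }
    (fun f g => by
      have key : ∀ i, (∑ᶠ m : ℕ, c i m * pd i m (f * g))
          = f * (∑ᶠ m : ℕ, c i m * pd i m g) + g * (∑ᶠ m : ℕ, c i m * pd i m f) := fun i => by
        rw [mul_finsum' _ _ (hs i g), mul_finsum' _ _ (hs i f), ← finsum_add_distrib]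
        · exact finsum_congr fun m => by
            rw [Derivation.leibniz, smul_eq_mul, smul_eq_mul]; ring
        · exact (hs i g).subset (fun m hm h0 => hm (by
            have h1 : c i m * pd i m g = 0 := h0
            simp [h1]))
        · exact (hs i f).subset (fun m hm h0 => hm (by
            have h1 : c i m * pd i m f = 0 := h0
            simp [h1]))
      simp only [LinearMap.coe_mk, AddHom.coe_mk, smul_eq_mul]
      rw [Finset.mul_sum, Finset.mul_sum, ← Finset.sum_add_distrib]
      exact Finset.sum_congr rfl fun i _ => key i)

end Generic

/-! ## Local functions in a coordinate domain -/

section Local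

variable {ι : Type*} [Fintype ι] (W : TopologicalSpace.Opens (ι → ℝ))

/-- Points `(t, u, u', u'', …)` of the infinite jet space over the coordinate domain `W`;
the coordinate `u_i^(m)` of `p` is `p.1.2 m i`. -/
abbrev JetPt : Type _ := {p : ℝ × (ℕ → ι → ℝ) // p.2 0 ∈ W}

/-- The domain of `k`-jets, `{(t, u, …, u^(k)) : u ∈ W}`. -/
def jetDom (k : ℕ) : Set (ℝ × (Fin (k + 1) → ι → ℝ)) := {v | v.2 0 ∈ W}

variable {W}

/-- The projection to the `k`-jet. -/
def trunc (k : ℕ) (q : ℝ × (ℕ → ι → ℝ)) : ℝ × (Fin (k + 1) → ι → ℝ) :=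
  (q.1, fun m => q.2 m)

/-- `f` is a smooth function of the `k`-jet. -/
def IsOfOrder (k : ℕ) (f : JetPt W → ℝ) : Prop :=
  ∃ F : ℝ × (Fin (k + 1) → ι → ℝ) → ℝ,
    ContDiffOn ℝ ∞ F (jetDom W k) ∧ ∀ p, f p = F (trunc k p.1)

/-- `f` is periodic in the loop coordinate `t`, that is, a function over the circle `ℝ / ℤ`. -/
def IsPeriodic (f : JetPt W → ℝ) : Prop :=
  ∀ (t : ℝ) (u : ℕ → ι → ℝ) (hu : u 0 ∈ W), f ⟨(t + 1, u), hu⟩ = f ⟨(t, u), hu⟩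

/-- `f` does not depend explicitly on the loop coordinate `t`. -/
def IsAutonomous (f : JetPt W → ℝ) : Prop :=
  ∀ (t s : ℝ) (u : ℕ → ι → ℝ) (hu : u 0 ∈ W), f ⟨(t, u), hu⟩ = f ⟨(s, u), hu⟩

open Classical in
/-- Extension by zero (only used to take derivatives at points of the open set). -/
def ext0 (f : JetPt W → ℝ) (q : ℝ × (ℕ → ι → ℝ)) : ℝ :=
  if h : q.2 0 ∈ W then f ⟨q, h⟩ else 0

/-- The jet `u` with the coordinate `u_i^(m)` replaced by `s`. -/
def setCoord [DecidableEq ι] (i : ι) (m : ℕ) (q : ℝ × (ℕ → ι → ℝ)) (s : ℝ) : ℝ × (ℕ → ι → ℝ) :=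
  (q.1, Function.update q.2 m (Function.update (q.2 m) i s))

/-- The partial derivative `∂f/∂u_i^(m)`. -/
def rawPD [DecidableEq ι] (i : ι) (m : ℕ) (f : JetPt W → ℝ) (p : JetPt W) : ℝ :=
  deriv (fun s => ext0 f (setCoord i m p.1 s)) (p.1.2 m i)

/-- The partial derivative `∂f/∂t`. -/
def rawTD (f : JetPt W → ℝ) (p : JetPt W) : ℝ :=
  deriv (fun s => f ⟨(s, p.1.2), p.2⟩) p.1.1

lemma isOpen_jetDom (k : ℕ) : IsOpen (jetDom W k) :=
  W.isOpen.preimage (by fun_prop : Continuous fun v : ℝ × (Fin (k + 1) → ι → ℝ) => v.2 0)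

lemma trunc_mem (k : ℕ) (p : JetPt W) : trunc k p.1 ∈ jetDom W k := p.2

lemma IsOfOrder.mono {k l : ℕ} (h : k ≤ l) {f : JetPt W → ℝ} (hf : IsOfOrder k f) :
    IsOfOrder l f := by
  obtain ⟨F, hF, hfF⟩ := hf
  refine ⟨fun v => F (v.1, fun m => v.2 (Fin.castLE (by omega) m)), ?_, fun p => hfF p⟩
  refine hF.comp (t := jetDom W k) (ContDiff.contDiffOn (by fun_prop)) ?_
  intro v hv
  exact hv

lemma ext0_of_mem (f : JetPt W → ℝ) {q : ℝ × (ℕ → ι → ℝ)} (h : q.2 0 ∈ W) :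
    ext0 f q = f ⟨q, h⟩ := dif_pos h

lemma IsOfOrder.ext0_eq {k : ℕ} {f : JetPt W → ℝ}
    {F : ℝ × (Fin (k + 1) → ι → ℝ) → ℝ} (hf : ∀ p : JetPt W, f p = F (trunc k p.1))
    {q : ℝ × (ℕ → ι → ℝ)} (h : q.2 0 ∈ W) : ext0 f q = F (trunc k q) := by
  rw [ext0_of_mem f h, hf]

lemma setCoord_self [DecidableEq ι] (i : ι) (m : ℕ) (q : ℝ × (ℕ → ι → ℝ)) :
    setCoord i m q (q.2 m i) = q := by
  simp [setCoord]

/-- The direction of the coordinate `u_i^(m)` in the space of `k`-jets. -/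
def coordDir [DecidableEq ι] (k : ℕ) (i : ι) (m : ℕ) : ℝ × (Fin (k + 1) → ι → ℝ) :=
  (0, fun n => if (n : ℕ) = m then Pi.single i 1 else 0)

lemma trunc_setCoord [DecidableEq ι] (k : ℕ) (i : ι) (m : ℕ) (q : ℝ × (ℕ → ι → ℝ)) (s : ℝ) :
    trunc k (setCoord i m q s) = trunc k q + (s - q.2 m i) • coordDir k i m := by
  refine Prod.ext ?_ ?_
  · simp [trunc, setCoord, coordDir]
  · funext n j
    by_cases hn : (n : ℕ) = m
    · by_cases hj : j = i
      · subst hj; simp [trunc, setCoord, coordDir, hn]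
      · simp [trunc, setCoord, coordDir, hn, hj]
    · simp [trunc, setCoord, coordDir, hn]

lemma setCoord_mem [DecidableEq ι] (i : ι) (m : ℕ) (p : JetPt W) :
    ∀ᶠ s in nhds (p.1.2 m i), (setCoord i m p.1 s).2 0 ∈ W := by
  have hc : Continuous fun s : ℝ => (trunc 0 (setCoord i m p.1 s)).2 0 := by
    simp only [trunc_setCoord]
    fun_prop
  refine hc.continuousAt.eventually (W.isOpen.mem_nhds ?_)
  change (setCoord i m p.1 (p.1.2 m i)).2 0 ∈ W
  rw [setCoord_self]
  exact p.2

lemma hasDerivAt_coord [DecidableEq ι] {k : ℕ} {f : JetPt W → ℝ}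
    {F : ℝ × (Fin (k + 1) → ι → ℝ) → ℝ} (hF : ContDiffOn ℝ ∞ F (jetDom W k))
    (hf : ∀ p, f p = F (trunc k p.1)) (i : ι) (m : ℕ) (p : JetPt W) :
    HasDerivAt (fun s => ext0 f (setCoord i m p.1 s))
      (fderiv ℝ F (trunc k p.1) (coordDir k i m)) (p.1.2 m i) := by
  have hd : DifferentiableAt ℝ F (trunc k p.1) :=
    (hF.contDiffAt ((isOpen_jetDom k).mem_nhds (trunc_mem k p))).differentiableAt (by simp)
  have h1 : HasDerivAt (fun s : ℝ => trunc k p.1 + (s - p.1.2 m i) • coordDir k i m)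
      (coordDir k i m) (p.1.2 m i) := by
    simpa using (((hasDerivAt_id (p.1.2 m i)).sub_const (p.1.2 m i)).smul_const
      (coordDir k i m)).const_add (trunc k p.1)
  have h2 : HasFDerivAt F (fderiv ℝ F (trunc k p.1))
      (trunc k p.1 + (p.1.2 m i - p.1.2 m i) • coordDir k i m) := by
    simpa using hd.hasFDerivAt
  refine (h2.comp_hasDerivAt _ h1).congr_of_eventuallyEq ?_
  filter_upwards [setCoord_mem i m p] with s hs
  rw [IsOfOrder.ext0_eq hf hs, trunc_setCoord]
  rfl

lemma hasDerivAt_time {k : ℕ} {f : JetPt W → ℝ}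
    {F : ℝ × (Fin (k + 1) → ι → ℝ) → ℝ} (hF : ContDiffOn ℝ ∞ F (jetDom W k))
    (hf : ∀ p, f p = F (trunc k p.1)) (p : JetPt W) :
    HasDerivAt (fun s => f ⟨(s, p.1.2), p.2⟩) (fderiv ℝ F (trunc k p.1) (1, 0)) p.1.1 := by
  have hd : DifferentiableAt ℝ F (trunc k p.1) :=
    (hF.contDiffAt ((isOpen_jetDom k).mem_nhds (trunc_mem k p))).differentiableAt (by simp)
  have h1 : HasDerivAt (fun s : ℝ => (s, (trunc k p.1).2)) ((1 : ℝ), 0) p.1.1 :=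
    (hasDerivAt_id p.1.1).prodMk (hasDerivAt_const _ _)
  have h2 : HasFDerivAt F (fderiv ℝ F (trunc k p.1)) (p.1.1, (trunc k p.1).2) :=
    hd.hasFDerivAt
  have h3 := h2.comp_hasDerivAt _ h1
  have e : (fun s => f ⟨(s, p.1.2), p.2⟩) = F ∘ fun s : ℝ => (s, (trunc k p.1).2) := by
    funext s
    rw [hf]
    rfl
  rw [e]
  exact h3

lemma contDiffOn_dir {k : ℕ} {F : ℝ × (Fin (k + 1) → ι → ℝ) → ℝ}
    (hF : ContDiffOn ℝ ∞ F (jetDom W k)) (v : ℝ × (Fin (k + 1) → ι → ℝ)) :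
    ContDiffOn ℝ ∞ (fun q => fderiv ℝ F q v) (jetDom W k) :=
  (hF.fderiv_of_isOpen (isOpen_jetDom k) (by simp)).clm_apply contDiffOn_const

lemma IsOfOrder.rawPD [DecidableEq ι] {k : ℕ} {f : JetPt W → ℝ} (hf : IsOfOrder k f) (i : ι)
    (m : ℕ) : IsOfOrder k (rawPD i m f) := by
  obtain ⟨F, hF, h⟩ := hf
  exact ⟨_, contDiffOn_dir hF (coordDir k i m), fun p => (hasDerivAt_coord hF h i m p).deriv⟩

lemma IsOfOrder.rawTD {k : ℕ} {f : JetPt W → ℝ} (hf : IsOfOrder k f) :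
    IsOfOrder k (rawTD f) := by
  obtain ⟨F, hF, h⟩ := hf
  exact ⟨_, contDiffOn_dir hF (1, 0), fun p => (hasDerivAt_time hF h p).deriv⟩

lemma IsOfOrder.rawPD_eq_zero [DecidableEq ι] {k : ℕ} {f : JetPt W → ℝ} (hf : IsOfOrder k f)
    (i : ι) {m : ℕ} (hm : k < m) : LoopPoisson.rawPD i m f = 0 := by
  obtain ⟨F, hF, h⟩ := hf
  funext p
  have h0 : coordDir k i m = 0 := by
    refine Prod.ext rfl ?_
    funext n
    have : (n : ℕ) ≠ m := by omega
    simp [coordDir, this]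
  have := (hasDerivAt_coord hF h i m p).deriv
  rw [h0, map_zero] at this
  exact this

lemma rawPD_congr_time [DecidableEq ι] {f : JetPt W → ℝ} {t s : ℝ}
    (h : ∀ (u : ℕ → ι → ℝ) (hu : u 0 ∈ W), f ⟨(t, u), hu⟩ = f ⟨(s, u), hu⟩) (i : ι) (m : ℕ)
    (u : ℕ → ι → ℝ) (hu : u 0 ∈ W) :
    rawPD i m f ⟨(t, u), hu⟩ = rawPD i m f ⟨(s, u), hu⟩ := by
  have e : (fun x => ext0 f (setCoord i m (t, u) x)) =
      fun x => ext0 f (setCoord i m (s, u) x) := by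
    funext x
    by_cases h1 : (setCoord i m (t, u) x).2 0 ∈ W
    · rw [ext0_of_mem f h1, ext0_of_mem f (q := setCoord i m (s, u) x) h1]
      exact h _ h1
    · have h2 : (setCoord i m (s, u) x).2 0 ∉ W := h1
      simp only [ext0]
      rw [dif_neg h1, dif_neg h2]
  simp only [rawPD, e]

lemma IsPeriodic.rawTD {f : JetPt W → ℝ} (hf : IsPeriodic f) : IsPeriodic (rawTD f) := by
  intro t u hu
  have e : (fun s => f ⟨(s, u), hu⟩) = fun s => f ⟨(s + 1, u), hu⟩ := by
    funext s
    exact (hf s u hu).symm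
  simp only [LoopPoisson.rawTD]
  conv_rhs => rw [e]
  rw [deriv_comp_add_const (f := fun s => f ⟨(s, u), hu⟩)]

variable (W)

/-- The algebra of smooth local functions of `(t, u, u', …)`, with `t` in the circle `ℝ / ℤ`
and `u` in the coordinate domain `W`. -/
def LocT : Subalgebra ℝ (JetPt W → ℝ) where
  carrier := {f | (∃ k, IsOfOrder k f) ∧ IsPeriodic f}
  mul_mem' := by
    rintro f g ⟨⟨k, hf⟩, hf'⟩ ⟨⟨l, hg⟩, hg'⟩
    obtain ⟨F, hF, h⟩ := hf.mono (le_max_left k l)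
    obtain ⟨G, hG, h'⟩ := hg.mono (le_max_right k l)
    refine ⟨⟨max k l, fun v => F v * G v, hF.mul hG, fun p => ?_⟩, fun t u hu => ?_⟩
    · simp [h, h']
    · simp [hf' t u hu, hg' t u hu]
  add_mem' := by
    rintro f g ⟨⟨k, hf⟩, hf'⟩ ⟨⟨l, hg⟩, hg'⟩
    obtain ⟨F, hF, h⟩ := hf.mono (le_max_left k l)
    obtain ⟨G, hG, h'⟩ := hg.mono (le_max_right k l)
    refine ⟨⟨max k l, fun v => F v + G v, hF.add hG, fun p => ?_⟩, fun t u hu => ?_⟩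
    · simp [h, h']
    · simp [hf' t u hu, hg' t u hu]
  algebraMap_mem' := fun r =>
    ⟨⟨0, fun _ => r, contDiffOn_const, fun _ => rfl⟩, fun _ _ _ => rfl⟩

/-- The algebra `V_loc` of smooth local functions of `(u, u', …)` that do not depend explicitly
on the loop coordinate. -/
def Vloc : Subalgebra ℝ (JetPt W → ℝ) where
  carrier := {f | f ∈ LocT W ∧ IsAutonomous f}
  mul_mem' := by
    rintro f g ⟨hf, hf'⟩ ⟨hg, hg'⟩
    exact ⟨mul_mem hf hg, fun t s u hu => by simp [hf' t s u hu, hg' t s u hu]⟩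
  add_mem' := by
    rintro f g ⟨hf, hf'⟩ ⟨hg, hg'⟩
    exact ⟨add_mem hf hg, fun t s u hu => by simp [hf' t s u hu, hg' t s u hu]⟩
  algebraMap_mem' := fun r => ⟨algebraMap_mem _ r, fun _ _ _ _ => rfl⟩

lemma vloc_le : Vloc W ≤ LocT W := fun _ h => h.1

variable {W}

lemma ext0_add (f g : JetPt W → ℝ) (q : ℝ × (ℕ → ι → ℝ)) :
    ext0 (f + g) q = ext0 f q + ext0 g q := by
  simp only [ext0]; split_ifs <;> simp

lemma ext0_mul (f g : JetPt W → ℝ) (q : ℝ × (ℕ → ι → ℝ)) :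
    ext0 (f * g) q = ext0 f q * ext0 g q := by
  simp only [ext0]; split_ifs <;> simp

lemma ext0_smul (r : ℝ) (f : JetPt W → ℝ) (q : ℝ × (ℕ → ι → ℝ)) :
    ext0 (r • f) q = r * ext0 f q := by
  simp only [ext0]; split_ifs <;> simp

lemma hasDerivAt_rawPD [DecidableEq ι] {f : JetPt W → ℝ} (hf : f ∈ LocT W) (i : ι) (m : ℕ)
    (p : JetPt W) :
    HasDerivAt (fun s => ext0 f (setCoord i m p.1 s)) (rawPD i m f p) (p.1.2 m i) := by
  obtain ⟨⟨k, F, hF, h⟩, -⟩ := hf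
  exact (hasDerivAt_coord hF h i m p).differentiableAt.hasDerivAt

lemma hasDerivAt_rawTD {f : JetPt W → ℝ} (hf : f ∈ LocT W) (p : JetPt W) :
    HasDerivAt (fun s => f ⟨(s, p.1.2), p.2⟩) (rawTD f p) p.1.1 := by
  obtain ⟨⟨k, F, hF, h⟩, -⟩ := hf
  exact (hasDerivAt_time hF h p).differentiableAt.hasDerivAt

/-- A map on functions that preserves `S` and is a derivation there, as a derivation of `S`. -/
def mkDer (S : Subalgebra ℝ (JetPt W → ℝ)) (T : (JetPt W → ℝ) → (JetPt W → ℝ))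
    (hm : ∀ f ∈ S, T f ∈ S) (hadd : ∀ f ∈ S, ∀ g ∈ S, T (f + g) = T f + T g)
    (hsmul : ∀ r : ℝ, ∀ f ∈ S, T (r • f) = r • T f)
    (hmul : ∀ f ∈ S, ∀ g ∈ S, T (f * g) = f * T g + g * T f) : Derivation ℝ S S :=
  Derivation.mk'
    { toFun := fun f => ⟨T f, hm f f.2⟩
      map_add' := fun f g => Subtype.ext (hadd f f.2 g g.2)
      map_smul' := fun r f => Subtype.ext (hsmul r f f.2) }
    (fun f g => Subtype.ext (hmul f f.2 g g.2))

lemma rawPD_add [DecidableEq ι] {f g : JetPt W → ℝ} (hf : f ∈ LocT W) (hg : g ∈ LocT W) (i : ι)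
    (m : ℕ) : rawPD i m (f + g) = rawPD i m f + rawPD i m g := by
  funext p
  have h := ((hasDerivAt_rawPD hf i m p).add (hasDerivAt_rawPD hg i m p)).deriv
  have e : (fun s => ext0 (f + g) (setCoord i m p.1 s)) =
      (fun s => ext0 f (setCoord i m p.1 s)) + fun s => ext0 g (setCoord i m p.1 s) := by
    funext s
    exact ext0_add f g _
  change deriv (fun s => ext0 (f + g) (setCoord i m p.1 s)) (p.1.2 m i) = _
  rw [e, h]
  rfl

lemma rawPD_smul [DecidableEq ι] (r : ℝ) {f : JetPt W → ℝ} (hf : f ∈ LocT W) (i : ι)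
    (m : ℕ) : rawPD i m (r • f) = r • rawPD i m f := by
  funext p
  have h := ((hasDerivAt_rawPD hf i m p).const_mul r).deriv
  simpa only [rawPD, ext0_smul, Pi.smul_apply, smul_eq_mul] using h

lemma rawPD_mul [DecidableEq ι] {f g : JetPt W → ℝ} (hf : f ∈ LocT W) (hg : g ∈ LocT W) (i : ι)
    (m : ℕ) : rawPD i m (f * g) = f * rawPD i m g + g * rawPD i m f := by
  funext p
  have h := ((hasDerivAt_rawPD hf i m p).mul (hasDerivAt_rawPD hg i m p)).deriv
  rw [setCoord_self, ext0_of_mem f p.2, ext0_of_mem g p.2] at h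
  have e : (fun s => ext0 (f * g) (setCoord i m p.1 s)) =
      (fun s => ext0 f (setCoord i m p.1 s)) * fun s => ext0 g (setCoord i m p.1 s) := by
    funext s
    exact ext0_mul f g _
  change deriv (fun s => ext0 (f * g) (setCoord i m p.1 s)) (p.1.2 m i) = _
  rw [e, h]
  simp only [Pi.add_apply, Pi.mul_apply]
  ring

lemma rawPD_mem [DecidableEq ι] {f : JetPt W → ℝ} (hf : f ∈ LocT W) (i : ι) (m : ℕ) :
    rawPD i m f ∈ LocT W := by
  obtain ⟨⟨k, h⟩, h'⟩ := hf
  exact ⟨⟨k, h.rawPD i m⟩, fun t u hu => rawPD_congr_time (h' t) i m u hu⟩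

lemma rawPD_mem' [DecidableEq ι] {f : JetPt W → ℝ} (hf : f ∈ Vloc W) (i : ι) (m : ℕ) :
    rawPD i m f ∈ Vloc W :=
  ⟨rawPD_mem hf.1 i m, fun t s u hu => rawPD_congr_time (hf.2 t s) i m u hu⟩

lemma rawPD_finite [DecidableEq ι] {f : JetPt W → ℝ} (hf : f ∈ LocT W) (i : ι) :
    {m | rawPD i m f ≠ 0}.Finite := by
  obtain ⟨⟨k, h⟩, -⟩ := hf
  refine (Set.finite_Iic k).subset fun m hm => ?_
  by_contra hk
  exact hm (h.rawPD_eq_zero i (not_le.mp hk))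

lemma coord_mem (i : ι) (m : ℕ) : (fun p : JetPt W => p.1.2 m i) ∈ Vloc W :=
  ⟨⟨⟨m, fun v => v.2 (Fin.last m) i, ContDiff.contDiffOn (by fun_prop), fun _ => rfl⟩,
    fun _ _ _ => rfl⟩, fun _ _ _ _ => rfl⟩

variable (W)

/-- The partial derivative `∂/∂u_i^(m)` of `t`-dependent local functions. -/
def pdT [DecidableEq ι] (i : ι) (m : ℕ) : Derivation ℝ (LocT W) (LocT W) :=
  mkDer (LocT W) (rawPD i m) (fun _ hf => rawPD_mem hf i m)
    (fun _ hf _ hg => rawPD_add hf hg i m) (fun r _ hf => rawPD_smul r hf i m)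
    (fun _ hf _ hg => rawPD_mul hf hg i m)

/-- The partial derivative `∂/∂u_i^(m)` on `V_loc`. -/
def pd [DecidableEq ι] (i : ι) (m : ℕ) : Derivation ℝ (Vloc W) (Vloc W) :=
  mkDer (Vloc W) (rawPD i m) (fun _ hf => rawPD_mem' hf i m)
    (fun _ hf _ hg => rawPD_add hf.1 hg.1 i m) (fun r _ hf => rawPD_smul r hf.1 i m)
    (fun _ hf _ hg => rawPD_mul hf.1 hg.1 i m)

/-- The partial derivative `∂/∂t` of `t`-dependent local functions. -/
def timeDer : Derivation ℝ (LocT W) (LocT W) :=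
  mkDer (LocT W) rawTD
    (fun _ hf => by
      obtain ⟨⟨k, h⟩, h'⟩ := hf
      exact ⟨⟨k, h.rawTD⟩, h'.rawTD⟩)
    (fun _ hf _ hg => funext fun p =>
      ((hasDerivAt_rawTD hf p).add (hasDerivAt_rawTD hg p)).deriv)
    (fun r _ hf => funext fun p => ((hasDerivAt_rawTD hf p).const_mul r).deriv)
    (fun f hf g hg => funext fun p => by
      refine ((hasDerivAt_rawTD hf p).mul (hasDerivAt_rawTD hg p)).deriv.trans ?_
      simp only [Pi.add_apply, Pi.mul_apply]
      ring)

/-- The total derivative `∂ f = ∑ u_i^(m+1) ∂f/∂u_i^(m)` on `V_loc`. -/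
def totalDer [DecidableEq ι] : Derivation ℝ (Vloc W) (Vloc W) :=
  evolutionDer (pd W)
    (fun i f => (rawPD_finite f.2.1 i).subset fun _ hm h0 => hm (Subtype.ext h0))
    (fun i m => ⟨_, coord_mem i (m + 1)⟩)

/-- The total derivative `∂ f = ∂f/∂t + ∑ u_i^(m+1) ∂f/∂u_i^(m)` of `t`-dependent local
functions. -/
def totalDerT [DecidableEq ι] : Derivation ℝ (LocT W) (LocT W) :=
  timeDer W + evolutionDer (pdT W)
    (fun i f => (rawPD_finite f.2 i).subset fun _ hm h0 => hm (Subtype.ext h0))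
    (fun i m => ⟨_, vloc_le W (coord_mem i (m + 1))⟩)

/-- The inclusion of `V_loc` into the `t`-dependent local functions. -/
def incl : Vloc W →ₐ[ℝ] LocT W := Subalgebra.inclusion (vloc_le W)

/-- The space of local functionals: `t`-dependent local functions modulo total derivatives.
The class of `f` is written `∫ f dt`. -/
abbrev Functional [DecidableEq ι] : Type _ :=
  LocT W ⧸ LinearMap.range (totalDerT W : LocT W →ₗ[ℝ] LocT W)

/-- The class `[f] = ∫ f dt` of a local function. -/
def cls [DecidableEq ι] (f : LocT W) : Functional W := Submodule.Quotient.mk f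

/-- Test functions: smooth functions on the circle `ℝ / ℤ`. -/
def Test : Subalgebra ℝ (ℝ → ℝ) where
  carrier := {φ | ContDiff ℝ ∞ φ ∧ Function.Periodic φ 1}
  mul_mem' := fun h h' => ⟨h.1.mul h'.1, h.2.mul h'.2⟩
  add_mem' := fun h h' => ⟨h.1.add h'.1, h.2.add h'.2⟩
  algebraMap_mem' := fun _ => ⟨contDiff_const, fun _ => rfl⟩

/-- A test function as a local function `(t, u, u', …) ↦ φ t`. -/
def testFn (φ : Test) : LocT W :=
  ⟨fun p => φ.1 p.1.1, ⟨0, fun v => φ.1 v.1, (φ.2.1.comp contDiff_fst).contDiffOn, fun _ => rfl⟩,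
    fun t _ _ => φ.2.2 t⟩

end Local

/-! ## The two brackets -/

section Brackets

variable {ι : Type*} [Fintype ι] [DecidableEq ι] {W : TopologicalSpace.Opens (ι → ℝ)}

/-- The local distribution `J_φ(f) = ∫ f φ dt`. -/
def J (φ : Test) (f : Vloc W) : Functional W := cls W (incl W f * testFn W φ)

/-- The density `∑ δb/δu_j {u_i_∂ u_j}_→ (δa/δu_i)`, where `{u_i_λ u_j} = B i j`. -/
def bracketDensity (B : ι → ι → (Vloc W)[X]) (a b : LocT W) : LocT W :=
  ∑ i, ∑ j, varDer (totalDerT W) (pdT W) j b *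
    applyRight ((B i j).map (incl W : Vloc W →+* LocT W)) (totalDerT W)
      (varDer (totalDerT W) (pdT W) i a)

/-- The bracket `{[a], [b]}` of the local functionals with densities `a` and `b`. -/
def functionalBracket (B : ι → ι → (Vloc W)[X]) (a b : LocT W) : Functional W :=
  cls W (bracketDensity B a b)

/-- The bracket `{J_φ(f), J_ψ(g)}` of local distributions. -/
def currentBracket (B : ι → ι → (Vloc W)[X]) (f g : Vloc W) (φ ψ : Test) : Functional W :=
  functionalBracket B (incl W f * testFn W φ) (incl W g * testFn W ψ)

/-- The anomalous term `∑_{j ≥ 1} ∫ ψ (∂_t^j φ) c_j dt`. -/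
def schwinger (c : ℕ → Vloc W) (φ ψ : Test) : Functional W :=
  ∑ᶠ (j : ℕ) (_ : 1 ≤ j), cls W (testFn W ψ * (timeDer W)^[j] (testFn W φ) * incl W (c j))

/-- `D` and `C_1, C_2, …` are a Dorfman bracket and Schwinger functions obtained from the bracket
of local distributions:
`{J_φ(f), J_ψ(g)} = J_{φψ}(D(f,g)) + ∑_{j ≥ 1} ∫ ψ (∂_t^j φ) C_j(f,g) dt` for all test
functions, the sum being finite for each `f` and `g`. -/
structure IsCurrentDecomposition (B : ι → ι → (Vloc W)[X]) (D : Vloc W → Vloc W → Vloc W)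
    (C : ℕ → Vloc W → Vloc W → Vloc W) : Prop where
  finite : ∀ f g, {j | 1 ≤ j ∧ C j f g ≠ 0}.Finite
  eq : ∀ f g φ ψ,
    currentBracket B f g φ ψ = J (φ * ψ) (D f g) + schwinger (fun j => C j f g) φ ψ

/-- The `λ`-bracket `{f_λ g}` on `V_loc` with `{u_i λ u_j} = B i j`. -/
def lam (B : ι → ι → (Vloc W)[X]) (f g : Vloc W) : (Vloc W)[X] :=
  lambdaBr (totalDer W) (pd W) B f g

/-- The `j`-th product `f_(j) g`, the `j`-th derivative of `{f_λ g}` at `λ = 0`. -/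
def jProd (B : ι → ι → (Vloc W)[X]) (j : ℕ) (f g : Vloc W) : Vloc W :=
  (derivative^[j] (lam B f g)).eval 0

/-- The bilinear form attached to the Schwinger functions,
`½ ∑_{j ≥ 1} (-∂)^(j-1) (C_j(f,g) + C_j(g,f))`. -/
def currentPairing (C : ℕ → Vloc W → Vloc W → Vloc W) (f g : Vloc W) : Vloc W :=
  (1 / 2 : ℝ) • ∑ᶠ (j : ℕ) (_ : 1 ≤ j), (fun x => -totalDer W x)^[j - 1] (C j f g + C j g f)

/-- The bilinear form attached to the `λ`-bracket,
`½ ∑_{j ≥ 1} (-∂)^(j-1)/j! d^j/dλ^j ({f_λ g} + {g_λ f})` at `λ = 0`. -/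
def lambdaPairing (B : ι → ι → (Vloc W)[X]) (f g : Vloc W) : Vloc W :=
  (1 / 2 : ℝ) • ∑ᶠ (j : ℕ) (_ : 1 ≤ j), (1 / (j.factorial : ℝ)) •
    (fun x => -totalDer W x)^[j - 1] ((derivative^[j] (lam B f g + lam B g f)).eval 0)

/-- `B` is a Poisson structure: the bracket of local functionals is a Lie bracket. -/
structure IsPoisson (B : ι → ι → (Vloc W)[X]) : Prop where
  skew : ∀ a b : LocT W, functionalBracket B a b = -functionalBracket B b a
  jacobi : ∀ a b c : LocT W,
    functionalBracket B a (bracketDensity B b c) =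
      functionalBracket B (bracketDensity B a b) c +
        functionalBracket B b (bracketDensity B a c)

end Brackets

/-- The axioms of a weak Courant-Dorfman algebra `(V, R, ⟨·,·⟩, ⟦·,·⟧, ∂)` with `V = R`. -/
structure IsWeakCourantDorfman {V : Type*} [AddCommGroup V] [Module ℝ V] (d : V →ₗ[ℝ] V)
    (pair br : V → V → V) : Prop where
  pair_linear : ∀ f, IsLinearMap ℝ (pair f)
  pair_symm : ∀ f g, pair f g = pair g f
  br_linear_left : ∀ g, IsLinearMap ℝ fun f => br f g
  br_linear_right : ∀ f, IsLinearMap ℝ (br f)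
  jacobi : ∀ f g h, br f (br g h) = br (br f g) h + br g (br f h)
  symm_part : ∀ f g, br f g + br g f = d (pair f g)
  exact_left : ∀ a f, br (d a) f = 0

end LoopPoisson

end

open LoopPoisson

/-!
The map `∑ P_k λ^k ↦ ∑ P_k ∂^k φ` (`symbolEval φ`) from `V_loc[λ]` to `t`-dependent local functions
intertwines `∂ + λ` with the total derivative `∂`. Since `∂/∂u_i^(m)` does not see test functions,
`δ(f φ)/δu_i = ∑ (-∂)^m (φ ∂f/∂u_i^(m))`, and integrating by parts the derivatives that fall on `ψ`
gives `{J_φ(f), J_ψ(g)} = ∫ ψ (symbolEval φ {f_λ g}) dt` (`currentBracket_eq`). So the coefficients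
of the `λ`-bracket are a decomposition of the bracket of local distributions.

They are the only one because a symbol is determined by these functionals (`eq_of_cls_symbolEval`).
The main point is that `∫ ψ h dt = 0` for all test functions `ψ` forces `h = 0`
(`eq_zero_of_cls_testFn_mul`): the variational derivatives of `ψ h` vanish
(`varDer_totalDerT`), and evaluating at powers of a test function with a simple zero shows that all
`∂h/∂u_i^(m)` vanish. Hence `h` depends on its jet only through the constant loop, and for `ψ` the
restriction of `h` to that loop, `h ^ 2` has a periodic, monotone primitive there. Powers of a test
function with a simple zero likewise separate the coefficients of `∑ P_k ∂^k φ`.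

For the weak Courant-Dorfman axioms, take `φ = 1`: `{∫ f dt, J_ψ(g)} = J_ψ(⟦f, g⟧)`
(`functionalBracket_incl`). The Jacobi identity of the functionals, which depend only on the classes
of the densities, becomes that of `⟦·,·⟧`; skew-symmetry, with all derivatives moved off `ψ`
(`cls_symbolEval`), becomes `⟦f, g⟧ + ⟦g, f⟧ = ∂⟨f, g⟩`; and `⟦∂a, f⟧ = 0` because `[∂a] = 0`.
-/

noncomputable section

namespace LoopPoisson

/-! ### Finite sums and bilinearity -/

section Generic

variable {ι : Type*} [Fintype ι] {S : Type*} [CommRing S] [Algebra ℝ S]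

lemma finsum_eq_sum_range {M : Type*} [AddCommMonoid M] {f : ℕ → M} {N : ℕ}
    (h : ∀ m, N ≤ m → f m = 0) : ∑ᶠ m, f m = ∑ m ∈ Finset.range N, f m := by
  refine finsum_eq_finsetSum_of_support_subset _ fun m hm => ?_
  simp only [Finset.coe_range, Set.mem_Iio]
  by_contra hN
  exact hm (h m (not_lt.mp hN))

lemma neg_iterate {M : Type*} [AddCommGroup M] [Module ℝ M] (L : M →ₗ[ℝ] M) (n : ℕ) (x : M) :
    (fun y => -L y)^[n] x = ((-L) ^ n) x := by
  rw [Module.End.pow_apply]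
  rfl

lemma varDer_eq_sum {d : Derivation ℝ S S} {pd : ι → ℕ → Derivation ℝ S S} {i : ι} {f : S}
    {N : ℕ} (h : ∀ m, N ≤ m → pd i m f = 0) :
    varDer d pd i f = ∑ m ∈ Finset.range N, ((-(d : S →ₗ[ℝ] S)) ^ m) (pd i m f) := by
  have e (m : ℕ) : (fun x => -d x)^[m] (pd i m f) = ((-(d : S →ₗ[ℝ] S)) ^ m) (pd i m f) :=
    neg_iterate (d : S →ₗ[ℝ] S) m _
  simp only [varDer, e]
  exact finsum_eq_sum_range fun m hm => by rw [h m hm, map_zero]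

/-- The linear map `x ↦ ∑ P_k (L^k x)` attached to a polynomial `P` and a linear operator `L`. -/
def applyRightLin {M : Type*} [AddCommGroup M] [Module S M] [Module ℝ M] [SMulCommClass ℝ S M]
    (P : S[X]) (L : M →ₗ[ℝ] M) : M →ₗ[ℝ] M where
  toFun := applyRight P L
  map_add' x y := by
    simp only [applyRight, Polynomial.sum, iterate_map_add, smul_add, Finset.sum_add_distrib]
  map_smul' r x := by
    have e (k : ℕ) (x : M) : (L^[k]) x = (L ^ k) x := (Module.End.pow_apply L k x).symm
    simp only [applyRight, Polynomial.sum, e, map_smul, Finset.smul_sum, RingHom.id_apply]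
    exact Finset.sum_congr rfl fun k _ => (smul_comm r _ _).symm

lemma applyRightLin_apply {M : Type*} [AddCommGroup M] [Module S M] [Module ℝ M]
    [SMulCommClass ℝ S M] (P : S[X]) (L : M →ₗ[ℝ] M) (x : M) :
    applyRightLin P L x = applyRight P L x := rfl

lemma coeff_shiftDer_zero (d : Derivation ℝ S S) (p : S[X]) :
    (shiftDer d p).coeff 0 = d (p.coeff 0) := by
  simp only [shiftDer, coeff_add, mul_coeff_zero, coeff_X_zero, zero_mul, add_zero, Polynomial.sum,
    finsetSum_coeff, coeff_monomial]
  simp +contextual [Finset.sum_ite_eq']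

lemma coeff_shiftDer_succ (d : Derivation ℝ S S) (p : S[X]) (k : ℕ) :
    (shiftDer d p).coeff (k + 1) = d (p.coeff (k + 1)) + p.coeff k := by
  simp only [shiftDer, coeff_add, coeff_X_mul, Polynomial.sum,
    finsetSum_coeff, coeff_monomial]
  simp +contextual [Finset.sum_ite_eq']

/-- The operator `∂ + λ` as a linear map. -/
def shiftDerLin (d : Derivation ℝ S S) : S[X] →ₗ[ℝ] S[X] where
  toFun := shiftDer d
  map_add' p q := by
    ext k
    cases k with
    | zero => simp [coeff_shiftDer_zero]
    | succ k => simp only [coeff_add, coeff_shiftDer_succ, map_add]; ring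
  map_smul' r p := by
    ext k
    cases k <;> simp [coeff_shiftDer_zero, coeff_shiftDer_succ]

/-- For `g` and `f` of bounded order the `λ`-bracket is a finite sum of compositions of linear
operators. -/
lemma lambdaBr_eq_sum {d : Derivation ℝ S S} {pd : ι → ℕ → Derivation ℝ S S}
     (B : ι → ι → S[X]) {f g : S} {N : ℕ} (hf : ∀ m, N ≤ m → ∀ i, pd i m f = 0)
    (hg : ∀ m, N ≤ m → ∀ i, pd i m g = 0) :
    lambdaBr d pd B f g = ∑ i, ∑ j, ∑ n ∈ Finset.range N, ∑ m ∈ Finset.range N,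
      C (pd j n g) * (shiftDerLin d ^ n) (applyRightLin (B i j) (shiftDerLin d)
        (((-shiftDerLin d) ^ m) (C (pd i m f)))) := by
  have e (m : ℕ) (x : S[X]) : (fun p => -shiftDer d p)^[m] x = ((-shiftDerLin d) ^ m) x :=
    neg_iterate (shiftDerLin d) m _
  have e' (m : ℕ) (x : S[X]) : (shiftDer d)^[m] x = (shiftDerLin d ^ m) x :=
    (Module.End.pow_apply (shiftDerLin d) m x).symm
  have e'' (P : S[X]) (x : S[X]) :
    applyRight P (shiftDer d) x = applyRightLin P (shiftDerLin d) x := rfl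
  simp only [lambdaBr, e, e', e'']
  refine Finset.sum_congr rfl fun i _ => Finset.sum_congr rfl fun j _ => ?_
  rw [finsum_eq_sum_range (N := N)]
  · refine Finset.sum_congr rfl fun n _ => finsum_eq_sum_range fun m hm => ?_
    rw [hf m hm i, C_0, map_zero, map_zero, map_zero, mul_zero]
  · intro n hn
    simp [hg n hn j]

section Bounded

variable {d : Derivation ℝ S S} {pd : ι → ℕ → Derivation ℝ S S}

lemma exists_common_bound (hpd : ∀ f, ∃ N, ∀ m, N ≤ m → ∀ i, pd i m f = 0)
    (f g h : S) : ∃ N, ∀ m, N ≤ m → ∀ i,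
    pd i m f = 0 ∧ pd i m g = 0 ∧ pd i m h = 0 := by
  obtain ⟨a, ha⟩ := hpd f
  obtain ⟨b, hb⟩ := hpd g
  obtain ⟨c, hc⟩ := hpd h
  exact ⟨max a (max b c), fun m hm i => ⟨ha m (by omega) i, hb m (by omega) i, hc m (by omega) i⟩⟩

lemma varDer_add (hpd : ∀ f, ∃ N, ∀ m, N ≤ m → ∀ i, pd i m f = 0)
    (i : ι) (f g : S) :
    varDer d pd i (f + g) = varDer d pd i f + varDer d pd i g := by
  obtain ⟨N, hN⟩ := exists_common_bound hpd f g (f + g)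
  rw [varDer_eq_sum fun m hm => (hN m hm i).1, varDer_eq_sum fun m hm => (hN m hm i).2.1,
    varDer_eq_sum fun m hm => (hN m hm i).2.2]
  simp only [map_add, Finset.sum_add_distrib]

lemma lambdaBr_add_left (hpd : ∀ f, ∃ N, ∀ m, N ≤ m → ∀ i, pd i m f = 0)
     (B : ι → ι → S[X]) (f f' g : S) :
    lambdaBr d pd B (f + f') g = lambdaBr d pd B f g + lambdaBr d pd B f' g := by
  obtain ⟨N, hN⟩ := exists_common_bound hpd f f' g
  have h1 := fun m hm i => (hN m hm i).1
  have h2 := fun m hm i => (hN m hm i).2.1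
  have h3 := fun m hm i => (hN m hm i).2.2
  rw [lambdaBr_eq_sum B h1 h3, lambdaBr_eq_sum B h2 h3,
    lambdaBr_eq_sum B (fun m hm i => by rw [map_add, h1 m hm i, h2 m hm i, add_zero]) h3]
  simp only [map_add, mul_add, Finset.sum_add_distrib]

lemma lambdaBr_add_right (hpd : ∀ f, ∃ N, ∀ m, N ≤ m → ∀ i, pd i m f = 0)
     (B : ι → ι → S[X]) (f g g' : S) :
    lambdaBr d pd B f (g + g') = lambdaBr d pd B f g + lambdaBr d pd B f g' := by
  obtain ⟨N, hN⟩ := exists_common_bound hpd g g' f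
  have h1 := fun m hm i => (hN m hm i).1
  have h2 := fun m hm i => (hN m hm i).2.1
  have h3 := fun m hm i => (hN m hm i).2.2
  rw [lambdaBr_eq_sum B h3 h1, lambdaBr_eq_sum B h3 h2,
    lambdaBr_eq_sum B h3 (fun m hm i => by rw [map_add, h1 m hm i, h2 m hm i, add_zero])]
  simp only [map_add, add_mul, Finset.sum_add_distrib]

lemma lambdaBr_smul_left (hpd : ∀ f, ∃ N, ∀ m, N ≤ m → ∀ i, pd i m f = 0)
     (B : ι → ι → S[X]) (r : ℝ) (f g : S) :
    lambdaBr d pd B (r • f) g = r • lambdaBr d pd B f g := by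
  obtain ⟨N, hN⟩ := exists_common_bound hpd f f g
  have h1 := fun m hm i => (hN m hm i).1
  have h3 := fun m hm i => (hN m hm i).2.2
  rw [lambdaBr_eq_sum B h1 h3,
    lambdaBr_eq_sum B (fun m hm i => by rw [Derivation.map_smul, h1 m hm i, smul_zero]) h3]
  simp only [Derivation.map_smul, map_smul, ← smul_C, mul_smul_comm, Finset.smul_sum]

lemma lambdaBr_smul_right (hpd : ∀ f, ∃ N, ∀ m, N ≤ m → ∀ i, pd i m f = 0)
     (B : ι → ι → S[X]) (r : ℝ) (f g : S) :
    lambdaBr d pd B f (r • g) = r • lambdaBr d pd B f g := by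
  obtain ⟨N, hN⟩ := exists_common_bound hpd f f g
  have h1 := fun m hm i => (hN m hm i).1
  have h3 := fun m hm i => (hN m hm i).2.2
  rw [lambdaBr_eq_sum B h1 h3,
    lambdaBr_eq_sum B h1 (fun m hm i => by rw [Derivation.map_smul, h3 m hm i, smul_zero])]
  simp only [Derivation.map_smul, ← smul_C, smul_mul_assoc, Finset.smul_sum]

/-- Setting `λ = 0` turns `∂ + λ` into `∂`. -/
lemma coeff_zero_lambdaBr (hpd : ∀ f, ∃ N, ∀ m, N ≤ m → ∀ i, pd i m f = 0)
     (B : ι → ι → S[X]) (f g : S) :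
    (lambdaBr d pd B f g).coeff 0 = ∑ i, ∑ j, ∑ᶠ n : ℕ, pd j n g * d^[n]
      (applyRight (B i j) d (varDer d pd i f)) := by
  obtain ⟨N, hN⟩ := exists_common_bound hpd f f g
  have h1 := fun m hm i => (hN m hm i).1
  have h3 := fun m hm i => (hN m hm i).2.2
  have e (n : ℕ) (p : S[X]) :
      ((shiftDerLin d ^ n) p).coeff 0 = ((d : S →ₗ[ℝ] S) ^ n) (p.coeff 0) := by
    induction n generalizing p with
    | zero => rfl
    | succ n ih =>
      rw [pow_succ, pow_succ, Module.End.mul_apply, Module.End.mul_apply, ih]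
      exact congrArg _ (coeff_shiftDer_zero d p)
  have e1 (n : ℕ) (p : S[X]) :
      (((-shiftDerLin d) ^ n) p).coeff 0 = ((-(d : S →ₗ[ℝ] S)) ^ n) (p.coeff 0) := by
    induction n generalizing p with
    | zero => rfl
    | succ n ih =>
      rw [pow_succ, pow_succ, Module.End.mul_apply, Module.End.mul_apply, ih]
      exact congrArg _ (by
        rw [LinearMap.neg_apply, LinearMap.neg_apply, coeff_neg]
        exact congrArg _ (coeff_shiftDer_zero d p))
  have e2 (P p : S[X]) : (applyRightLin P (shiftDerLin d) p).coeff 0 =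
      applyRightLin P (d : S →ₗ[ℝ] S) (p.coeff 0) := by
    simp only [applyRightLin_apply, applyRight, Polynomial.sum, finsetSum_coeff, coeff_smul,
      ← Module.End.pow_apply, e]
  have e3 (n : ℕ) (x : S) : d^[n] x = ((d : S →ₗ[ℝ] S) ^ n) x :=
    (Module.End.pow_apply (d : S →ₗ[ℝ] S) n x).symm
  have e4 (P : S[X]) (x : S) : applyRight P d x = applyRightLin P (d : S →ₗ[ℝ] S) x := rfl
  rw [lambdaBr_eq_sum B h1 h3]
  simp only [finsetSum_coeff, mul_coeff_zero, coeff_C_zero, e, e1, e2, e3, e4]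
  refine Finset.sum_congr rfl fun i _ => Finset.sum_congr rfl fun j _ => ?_
  rw [finsum_eq_sum_range (N := N) fun n hn => by rw [h3 n hn j, zero_mul]]
  simp only [varDer_eq_sum fun m hm => h1 m hm i, map_sum, Finset.mul_sum]

end Bounded

/-! ### Iterated derivatives of powers -/

/-- Up to `n` derivatives of a multiple of `s ^ (m + n)` leave a multiple of `s ^ n`. -/
lemma pow_dvd_iterate_derivation (d : Derivation ℝ S S) (s : S) (m n : ℕ) (a : S) :
    s ^ n ∣ ((d : S →ₗ[ℝ] S) ^ m) (s ^ (m + n) * a) := by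
  induction m generalizing a with
  | zero => simp
  | succ m ih =>
    rw [pow_succ, Module.End.mul_apply]
    have : (d : S →ₗ[ℝ] S) (s ^ (m + 1 + n) * a) =
        s ^ (m + n) * (((m + 1 + n : ℕ) : S) * (d s * a) + s * d a) := by
      simp only [Derivation.coeFn_coe, Derivation.leibniz, Derivation.leibniz_pow, smul_eq_mul,
        nsmul_eq_mul]
      rw [show m + 1 + n - 1 = m + n by omega, show m + 1 + n = m + n + 1 by omega]
      ring
    rw [this]
    exact ih _

/-- All `m` derivatives have to hit the factor `s ^ m` to leave no factor `s`. -/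
lemma dvd_iterate_derivation_sub (d : Derivation ℝ S S) (s : S) (m : ℕ) (a : S) :
    s ∣ ((d : S →ₗ[ℝ] S) ^ m) (s ^ m * a) - (m.factorial : S) * d s ^ m * a := by
  induction m generalizing a with
  | zero => simp
  | succ m ih =>
    rw [pow_succ, Module.End.mul_apply]
    have : (d : S →ₗ[ℝ] S) (s ^ (m + 1) * a) =
        s ^ m * (((m + 1 : ℕ) : S) * (d s * a)) + s ^ (m + 1) * d a := by
      simp only [Derivation.coeFn_coe, Derivation.leibniz, Derivation.leibniz_pow, smul_eq_mul,
        nsmul_eq_mul]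
      rw [show m + 1 - 1 = m by omega]
      ring
    rw [this, map_add]
    have h1 := ih (((m + 1 : ℕ) : S) * (d s * a))
    have h2 := pow_dvd_iterate_derivation d s m 1 (d a)
    rw [pow_one] at h2
    convert dvd_add h1 h2 using 1
    rw [Nat.factorial_succ]
    push_cast
    ring

end Generic

/-! ### Commutation of derivatives on the jet space -/

section Jets

variable {ι : Type*} [Fintype ι] [DecidableEq ι] {W : TopologicalSpace.Opens (ι → ℝ)}

lemma fderiv_dir_comm {k : ℕ} {F : ℝ × (Fin (k + 1) → ι → ℝ) → ℝ}
    (hF : ContDiffOn ℝ ∞ F (jetDom W k)) {x : ℝ × (Fin (k + 1) → ι → ℝ)} (hx : x ∈ jetDom W k)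
    (v w : ℝ × (Fin (k + 1) → ι → ℝ)) :
    fderiv ℝ (fun q => fderiv ℝ F q v) x w = fderiv ℝ (fun q => fderiv ℝ F q w) x v := by
  have h1 : ContDiffAt ℝ ∞ F x := hF.contDiffAt ((isOpen_jetDom k).mem_nhds hx)
  have h2 : DifferentiableAt ℝ (fderiv ℝ F) x :=
    (h1.fderiv_right (m := ∞) (by simp)).differentiableAt (by simp)
  have h3 : IsSymmSndFDerivAt ℝ F x := h1.isSymmSndFDerivAt (by
    rw [minSmoothness_of_isRCLikeNormedField]
    exact WithTop.coe_le_coe.mpr le_top)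
  rw [fderiv_clm_apply h2 (differentiableAt_const v),
    fderiv_clm_apply h2 (differentiableAt_const w)]
  simpa using h3 w v

lemma rawPD_comm {f : JetPt W → ℝ} (hf : f ∈ LocT W) (i j : ι) (m n : ℕ) :
    rawPD i m (rawPD j n f) = rawPD j n (rawPD i m f) := by
  obtain ⟨⟨k, F, hF, h⟩, -⟩ := hf
  funext p
  have e1 (i : ι) (m : ℕ) (p : JetPt W) :
      rawPD i m f p = (fun q => fderiv ℝ F q (coordDir k i m)) (trunc k p.1) :=
    (hasDerivAt_coord hF h i m p).deriv
  have e2 := (hasDerivAt_coord (contDiffOn_dir hF (coordDir k j n)) (e1 j n) i m p).deriv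
  have e3 := (hasDerivAt_coord (contDiffOn_dir hF (coordDir k i m)) (e1 i m) j n p).deriv
  exact e2.trans ((fderiv_dir_comm hF (trunc_mem k p) _ _).trans e3.symm)

lemma rawPD_rawTD {f : JetPt W → ℝ} (hf : f ∈ LocT W) (i : ι) (m : ℕ) :
    rawPD i m (rawTD f) = rawTD (rawPD i m f) := by
  obtain ⟨⟨k, F, hF, h⟩, -⟩ := hf
  funext p
  have e1 (p : JetPt W) :
      rawPD i m f p = (fun q => fderiv ℝ F q (coordDir k i m)) (trunc k p.1) :=
    (hasDerivAt_coord hF h i m p).deriv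
  have e0 (p : JetPt W) : rawTD f p = (fun q => fderiv ℝ F q (1, 0)) (trunc k p.1) :=
    (hasDerivAt_time hF h p).deriv
  have e2 := (hasDerivAt_coord (contDiffOn_dir hF (1, 0)) e0 i m p).deriv
  have e3 := (hasDerivAt_time (contDiffOn_dir hF (coordDir k i m)) e1 p).deriv
  exact e2.trans ((fderiv_dir_comm hF (trunc_mem k p) _ _).trans e3.symm)

lemma exists_pdT_bound (f : LocT W) : ∃ N, ∀ m, N ≤ m → ∀ i, pdT W i m f = 0 := by
  obtain ⟨k, hk⟩ := f.2.1
  exact ⟨k + 1, fun m hm i => Subtype.ext (hk.rawPD_eq_zero i hm)⟩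

lemma exists_pd_bound (f : Vloc W) : ∃ N, ∀ m, N ≤ m → ∀ i, pd W i m f = 0 := by
  obtain ⟨k, hk⟩ := f.2.1.1
  exact ⟨k + 1, fun m hm i => Subtype.ext (hk.rawPD_eq_zero i hm)⟩

variable (W) in
/-- The jet coordinate `u_i^(m)` as a local function. -/
def jetCoord (i : ι) (m : ℕ) : LocT W := ⟨_, vloc_le W (coord_mem i m)⟩

lemma totalDerT_eq_sum {f : LocT W} {N : ℕ} (h : ∀ m, N ≤ m → ∀ i, pdT W i m f = 0) :
    totalDerT W f = timeDer W f +
      ∑ i, ∑ m ∈ Finset.range N, jetCoord W i (m + 1) * pdT W i m f := by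
  have e : totalDerT W f = timeDer W f + ∑ i, ∑ᶠ m, jetCoord W i (m + 1) * pdT W i m f := rfl
  rw [e]
  congr 1
  refine Finset.sum_congr rfl fun i _ => finsum_eq_sum_range fun m hm => ?_
  rw [h m hm, mul_zero]

lemma pdT_jetCoord (i j : ι) (m n : ℕ) :
    pdT W i m (jetCoord W j n) = if j = i ∧ n = m then 1 else 0 := by
  refine Subtype.ext (funext fun p => ?_)
  have e : (fun s => ext0 (fun p : JetPt W => p.1.2 n j) (setCoord i m p.1 s)) =ᶠ[nhds (p.1.2 m i)]
      fun s => if j = i ∧ n = m then s else p.1.2 n j := by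
    filter_upwards [setCoord_mem i m p] with s hs
    rw [ext0_of_mem _ hs]
    by_cases hn : n = m
    · subst hn
      by_cases hj : j = i
      · subst hj; simp [setCoord]
      · simp [setCoord, hj]
    · simp [setCoord, hn]
  refine (Filter.EventuallyEq.deriv_eq e).trans ?_
  split_ifs
  · exact deriv_id _
  · exact deriv_const _ _

lemma pdT_comm (i j : ι) (m n : ℕ) (f : LocT W) :
    pdT W i m (pdT W j n f) = pdT W j n (pdT W i m f) :=
  Subtype.ext (rawPD_comm f.2 i j m n)

lemma pdT_timeDer (i : ι) (m : ℕ) (f : LocT W) :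
    pdT W i m (timeDer W f) = timeDer W (pdT W i m f) :=
  Subtype.ext (rawPD_rawTD f.2 i m)

/-- The commutator of `∂/∂u_i^(m)` with the total derivative is `∂/∂u_i^(m-1)`, written as a sum
because it is absent for `m = 0`. -/
lemma pdT_totalDerT (i : ι) (m N : ℕ) (f : LocT W)
    (h : ∀ m, N ≤ m → ∀ i, pdT W i m f = 0) :
    pdT W i m (totalDerT W f) = totalDerT W (pdT W i m f) +
      ∑ n ∈ Finset.range N, if n + 1 = m then pdT W i n f else 0 := by
  rw [totalDerT_eq_sum h, totalDerT_eq_sum (f := pdT W i m f) (N := N)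
    fun n hn j => by rw [pdT_comm, h n hn j, map_zero]]
  simp only [map_add, map_sum, Derivation.leibniz, smul_eq_mul, pdT_timeDer, pdT_jetCoord,
    Finset.sum_add_distrib, pdT_comm i]
  rw [add_assoc]
  congr 2
  rw [Finset.sum_eq_single i]
  · exact Finset.sum_congr rfl fun n _ => by split_ifs <;> simp_all
  · intro j _ hj
    simp [hj]
  · simp

lemma pdT_zero_totalDerT (i : ι) (f : LocT W) :
    pdT W i 0 (totalDerT W f) = totalDerT W (pdT W i 0 f) := by
  obtain ⟨N, hN⟩ := exists_pdT_bound f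
  simp [pdT_totalDerT i 0 N f hN]

lemma pdT_succ_totalDerT (i : ι) (m : ℕ) (f : LocT W) :
    pdT W i (m + 1) (totalDerT W f) = totalDerT W (pdT W i (m + 1) f) + pdT W i m f := by
  obtain ⟨N, hN⟩ := exists_pdT_bound f
  rw [pdT_totalDerT i (m + 1) N f hN]
  congr 1
  simp only [add_left_inj, Finset.sum_ite_eq', Finset.mem_range]
  split_ifs with h
  · rfl
  · exact (hN m (not_lt.mp h) i).symm

/-- Variational derivatives annihilate total derivatives: the sum telescopes. -/
lemma varDer_totalDerT (i : ι) (f : LocT W) :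
    varDer (totalDerT W) (pdT W) i (totalDerT W f) = 0 := by
  obtain ⟨N, hN⟩ := exists_pdT_bound f
  have key (M : ℕ) : ∑ m ∈ Finset.range (M + 1),
      ((-(totalDerT W : LocT W →ₗ[ℝ] LocT W)) ^ m) (pdT W i m (totalDerT W f)) =
      -((-(totalDerT W : LocT W →ₗ[ℝ] LocT W)) ^ (M + 1)) (pdT W i M f) := by
    induction M with
    | zero => simp [pdT_zero_totalDerT]
    | succ M ih =>
      rw [Finset.sum_range_succ, ih, pdT_succ_totalDerT, map_add, pow_succ _ (M + 1),
        Module.End.mul_apply]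
      simp
  rw [varDer_eq_sum (N := N + 1) fun m hm => ?_, key, hN N le_rfl, map_zero, neg_zero]
  obtain ⟨m, rfl⟩ : ∃ l, m = l + 1 := ⟨m - 1, by omega⟩
  rw [pdT_succ_totalDerT, hN _ (by omega), hN _ (by omega), map_zero, add_zero]

lemma varDer_congr {a b : LocT W} (h : cls W a = cls W b) (i : ι) :
    varDer (totalDerT W) (pdT W) i a = varDer (totalDerT W) (pdT W) i b := by
  obtain ⟨c, hc⟩ := (Submodule.Quotient.eq _).mp h
  have : a = b + totalDerT W c := by
    rw [Derivation.coeFn_coe] at hc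
    rw [hc]; ring
  rw [this, varDer_add exists_pdT_bound, varDer_totalDerT, add_zero]

lemma cls_eq_zero {a : LocT W} : cls W a = 0 ↔ ∃ b, totalDerT W b = a :=
  Submodule.Quotient.mk_eq_zero _

/-! ### Autonomous functions and test functions -/

lemma pdT_incl (i : ι) (m : ℕ) (f : Vloc W) : pdT W i m (incl W f) = incl W (pd W i m f) := rfl

lemma incl_injective : Function.Injective (incl W) := Subalgebra.inclusion_injective _

lemma timeDer_incl (f : Vloc W) : timeDer W (incl W f) = 0 := by
  refine Subtype.ext (funext fun p => ?_)
  have e : (fun s => f.1 ⟨(s, p.1.2), p.2⟩) = fun _ => f.1 p := by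
    funext s
    exact f.2.2 s p.1.1 p.1.2 p.2
  change deriv (fun s => f.1 ⟨(s, p.1.2), p.2⟩) p.1.1 = 0
  rw [e, deriv_const]

lemma totalDerT_incl (f : Vloc W) : totalDerT W (incl W f) = incl W (totalDer W f) := by
  obtain ⟨N, hN⟩ := exists_pd_bound f
  have e : totalDer W f =
      ∑ i, ∑ᶠ m, (⟨_, coord_mem i (m + 1)⟩ : Vloc W) * pd W i m f := rfl
  rw [totalDerT_eq_sum (N := N) fun m hm i => by rw [pdT_incl, hN m hm i, map_zero],
    timeDer_incl, zero_add, e, map_sum]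
  refine Finset.sum_congr rfl fun i _ => ?_
  rw [finsum_eq_sum_range fun m hm => by rw [hN m hm i, mul_zero], map_sum]
  rfl

/-- The derivative of a test function. -/
def testDeriv (φ : Test) : Test :=
  ⟨deriv φ.1, (contDiff_infty_iff_deriv.mp φ.2.1).2, fun t => by
    rw [← deriv_comp_add_const]
    congr 1
    exact funext φ.2.2⟩

lemma timeDer_testFn (φ : Test) : timeDer W (testFn W φ) = testFn W (testDeriv φ) := rfl

lemma pdT_testFn (i : ι) (m : ℕ) (φ : Test) : pdT W i m (testFn W φ) = 0 := by
  refine Subtype.ext (funext fun p => ?_)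
  have e : (fun s => ext0 (testFn W φ).1 (setCoord i m p.1 s)) =ᶠ[nhds (p.1.2 m i)]
      fun _ => φ.1 p.1.1 := by
    filter_upwards [setCoord_mem i m p] with s hs
    rw [ext0_of_mem _ hs]
    rfl
  change deriv _ _ = _
  rw [Filter.EventuallyEq.deriv_eq e, deriv_const]
  rfl

lemma totalDerT_testFn (φ : Test) : totalDerT W (testFn W φ) = testFn W (testDeriv φ) := by
  rw [totalDerT_eq_sum (N := 0) fun m _ i => pdT_testFn i m φ, timeDer_testFn]
  simp

lemma iterate_timeDer_testFn (k : ℕ) (φ : Test) :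
    (timeDer W)^[k] (testFn W φ) = (totalDerT W)^[k] (testFn W φ) := by
  induction k generalizing φ with
  | zero => rfl
  | succ k ih =>
    rw [Function.iterate_succ_apply, Function.iterate_succ_apply, timeDer_testFn,
      totalDerT_testFn, ih]

lemma testFn_mul (φ ψ : Test) : testFn W (φ * ψ) = testFn W φ * testFn W ψ := rfl

lemma testFn_one : testFn W 1 = 1 := rfl

lemma testFn_pow (φ : Test) (n : ℕ) : testFn W (φ ^ n) = testFn W φ ^ n := by
  induction n with
  | zero => rfl
  | succ n ih => rw [pow_succ, pow_succ, testFn_mul, ih]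

/-- For every `t` there is a test function with a simple zero at `t`. -/
lemma exists_test_simple_zero (t : ℝ) : ∃ s : Test, s.1 t = 0 ∧ (testDeriv s).1 t ≠ 0 := by
  refine ⟨⟨fun x => Real.sin (2 * Real.pi * (x - t)), by fun_prop, fun x => ?_⟩, by simp, ?_⟩
  · change Real.sin (2 * Real.pi * (x + 1 - t)) = Real.sin (2 * Real.pi * (x - t))
    rw [show 2 * Real.pi * (x + 1 - t) = 2 * Real.pi * (x - t) + 2 * Real.pi by ring,
      Real.sin_add_two_pi]
  · have h : HasDerivAt (fun x => Real.sin (2 * Real.pi * (x - t)))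
        (Real.cos (2 * Real.pi * (t - t)) * (2 * Real.pi * 1)) t :=
      (((hasDerivAt_id t).sub_const t).const_mul (2 * Real.pi)).sin
    change deriv (fun x => Real.sin (2 * Real.pi * (x - t))) t ≠ 0
    rw [h.deriv]
    simp [Real.pi_ne_zero]

end Jets

/-! ### Separation of local functions by test functions -/

section Separation

variable {ι : Type*} [Fintype ι] [DecidableEq ι] {W : TopologicalSpace.Opens (ι → ℝ)}

lemma sum_coe_apply {κ : Type*} (s : Finset κ) (a : κ → LocT W) (p : JetPt W) :
    (∑ k ∈ s, a k).1 p = ∑ k ∈ s, (a k).1 p := by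
  rw [AddSubmonoidClass.coe_finsetSum, Finset.sum_apply]

lemma apply_eq_zero_of_dvd {a b : LocT W} (h : a ∣ b) {p : JetPt W} (ha : a.1 p = 0) :
    b.1 p = 0 := by
  obtain ⟨c, rfl⟩ := h
  change a.1 p * c.1 p = 0
  rw [ha, zero_mul]

/-- Let `s` be a test function with a simple zero at `t`. At points over `t`, the `m`-th derivative
of `s ^ n * a` vanishes for `m < n`, and for `m = n` it is a non-zero multiple of `a`. -/
lemma derivation_testFn_pow (d : Derivation ℝ (LocT W) (LocT W)) {p : JetPt W} {s : Test}
    (hs : s.1 p.1.1 = 0) (hd : (d (testFn W s)).1 p ≠ 0) (n : ℕ) :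
    (∀ m < n, ∀ a, (((d : LocT W →ₗ[ℝ] LocT W) ^ m) (testFn W (s ^ n) * a)).1 p = 0) ∧
    ∃ c : ℝ, c ≠ 0 ∧
      ∀ a, (((d : LocT W →ₗ[ℝ] LocT W) ^ n) (testFn W (s ^ n) * a)).1 p = c * a.1 p := by
  refine ⟨fun m hm a => ?_, n.factorial * (d (testFn W s)).1 p ^ n,
    mul_ne_zero (by exact_mod_cast n.factorial_ne_zero) (pow_ne_zero _ hd), fun a => ?_⟩
  · obtain ⟨l, rfl⟩ : ∃ l, n = m + (l + 1) := ⟨n - m - 1, by omega⟩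
    rw [testFn_pow]
    exact apply_eq_zero_of_dvd
      ((dvd_pow_self _ l.succ_ne_zero).trans (pow_dvd_iterate_derivation d _ m (l + 1) a)) hs
  · have h := apply_eq_zero_of_dvd (p := p) (dvd_iterate_derivation_sub d (testFn W s) n a) hs
    rw [testFn_pow]
    exact sub_eq_zero.mp h

/-- A differential operator `ψ ↦ ∑ (-∂)^m (a_m ψ)` that annihilates all test functions is zero. -/
lemma eq_zero_of_adjoint_test {N : ℕ} {a : ℕ → LocT W}
    (h : ∀ ψ : Test, ∑ m ∈ Finset.range N,
      ((-(totalDerT W : LocT W →ₗ[ℝ] LocT W)) ^ m) (testFn W ψ * a m) = 0) :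
    ∀ m < N, a m = 0 := by
  induction N with
  | zero => intro m hm; omega
  | succ N ih =>
    have hN : a N = 0 := by
      refine Subtype.ext (funext fun p => ?_)
      obtain ⟨s, hs, hs'⟩ := exists_test_simple_zero p.1.1
      obtain ⟨h0, c, hc, h1⟩ := derivation_testFn_pow (-totalDerT W) (p := p) hs (by
        rw [Derivation.neg_apply, totalDerT_testFn]
        exact neg_ne_zero.mpr hs') N
      have e := congrArg (fun x : LocT W => x.1 p) (h (s ^ N))
      rw [Finset.sum_range_succ] at e
      have e' : (∑ m ∈ Finset.range N,
          ((-(totalDerT W : LocT W →ₗ[ℝ] LocT W)) ^ m) (testFn W (s ^ N) * a m)).1 p = 0 := by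
        rw [sum_coe_apply]
        exact Finset.sum_eq_zero fun m hm => h0 m (Finset.mem_range.mp hm) (a m)
      have e'' : c * (a N).1 p = 0 := by
        rw [← h1 (a N)]
        exact (zero_add _).symm.trans ((congrArg (· + _) e').symm.trans e)
      exact (mul_eq_zero.mp e'').resolve_left hc
    intro m hm
    rcases Nat.lt_succ_iff_lt_or_eq.mp hm with hm | rfl
    · refine ih (fun ψ => ?_) m hm
      have := h ψ
      rwa [Finset.sum_range_succ, hN, mul_zero, map_zero, add_zero] at this
    · exact hN

/-- A differential operator `ψ ↦ ∑ a_m ∂^m ψ` that annihilates all test functions is zero. -/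
lemma eq_zero_of_operator_test {N : ℕ} {a : ℕ → LocT W}
    (h : ∀ ψ : Test, ∑ m ∈ Finset.range N, a m * (totalDerT W)^[m] (testFn W ψ) = 0) :
    ∀ m < N, a m = 0 := by
  induction N with
  | zero => intro m hm; omega
  | succ N ih =>
    have hN : a N = 0 := by
      refine Subtype.ext (funext fun p => ?_)
      obtain ⟨s, hs, hs'⟩ := exists_test_simple_zero p.1.1
      obtain ⟨h0, c, hc, h1⟩ := derivation_testFn_pow (totalDerT W) (p := p) hs (by
        rw [totalDerT_testFn]
        exact hs') N
      have it (m : ℕ) (x : LocT W) : (totalDerT W)^[m] x =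
        ((totalDerT W : LocT W →ₗ[ℝ] LocT W) ^ m) (x * 1) := by
          rw [mul_one, Module.End.pow_apply]; rfl
      have e := congrArg (fun x : LocT W => x.1 p) (h (s ^ N))
      rw [Finset.sum_range_succ] at e
      have e' : (∑ m ∈ Finset.range N, a m * (totalDerT W)^[m] (testFn W (s ^ N))).1 p = 0 := by
        rw [sum_coe_apply]
        refine Finset.sum_eq_zero fun m hm => ?_
        rw [it]
        change (a m).1 p * _ = 0
        rw [h0 m (Finset.mem_range.mp hm) 1, mul_zero]
      have e'' : (a N).1 p * c = 0 := by
        have h2 := h1 1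
        rw [← it] at h2
        have h3 : c * (1 : LocT W).1 p = c := mul_one c
        rw [← h3, ← h2]
        exact (zero_add _).symm.trans ((congrArg (· + _) e').symm.trans e)
      exact (mul_eq_zero.mp e'').resolve_right hc
    intro m hm
    rcases Nat.lt_succ_iff_lt_or_eq.mp hm with hm | rfl
    · refine ih (fun ψ => ?_) m hm
      have := h ψ
      rwa [Finset.sum_range_succ, hN, zero_mul, add_zero] at this
    · exact hN

/-- The jet of the constant loop at `x`. -/
def constJet (x : ι → ℝ) (m : ℕ) : ι → ℝ := if m = 0 then x else 0

lemma constJet_mem {x : ι → ℝ} (hx : x ∈ W) : constJet x 0 ∈ W := hx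

/-- A local function whose partial derivatives in the jet coordinates vanish depends on `t` and `u`
only through the constant loop: the fibres of the jet space over `W` are vector spaces. -/
lemma apply_eq_apply_constJet {h : LocT W} (hpd : ∀ i m, pdT W i m h = 0) (t : ℝ)
    (u : ℕ → ι → ℝ) (hu : u 0 ∈ W) :
    h.1 ⟨(t, u), hu⟩ = h.1 ⟨(t, constJet (u 0)), constJet_mem hu⟩ := by
  obtain ⟨⟨k, F, hF, hf⟩, -⟩ := h.2
  have hz (p : JetPt W) (i : ι) (m : ℕ) : fderiv ℝ F (trunc k p.1) (coordDir k i m) = 0 := by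
    rw [← (hasDerivAt_coord hF hf i m p).deriv]
    exact congrArg (fun x : LocT W => x.1 p) (hpd i m)
  let c (r : ℝ) (m : ℕ) : ι → ℝ := constJet (u 0) m + r • (u m - constJet (u 0) m)
  have hc (r : ℝ) : c r 0 = u 0 := by simp [c, constJet]
  have hc' (r : ℝ) : c r 0 ∈ W := by rw [hc]; exact hu
  let v : ℝ × (Fin (k + 1) → ι → ℝ) := (0, fun m => u m - constJet (u 0) m)
  have hv : v = ∑ i, ∑ m : Fin (k + 1), v.2 m i • coordDir k i m := by
    refine Prod.ext ?_ (funext fun n => funext fun j => ?_)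
    · simp [v, coordDir, Prod.fst_sum]
    · simp [coordDir, Prod.snd_sum, Finset.sum_apply, Fin.val_inj, Pi.single_apply,
        Finset.sum_ite_eq]
  have hd (r : ℝ) : HasDerivAt (fun r => F (trunc k (t, c r))) 0 r := by
    have h1 : HasDerivAt (fun r => trunc k (t, c r)) v r := by
      have e : (fun r => trunc k (t, c r)) = fun r => trunc k (t, c 0) + r • v := by
        funext r
        refine Prod.ext ?_ (funext fun n => ?_)
        · simp [trunc, v]
        · simp [trunc, v, c]
      rw [e]
      simpa using ((hasDerivAt_id r).smul_const v).const_add (trunc k (t, c 0))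
    have h2 : DifferentiableAt ℝ F (trunc k (t, c r)) :=
      (hF.contDiffAt ((isOpen_jetDom k).mem_nhds (trunc_mem k ⟨(t, c r), hc' r⟩))).differentiableAt
        (by simp)
    have h3 := h2.hasFDerivAt.comp_hasDerivAt r h1
    have h4 : fderiv ℝ F (trunc k (t, c r)) v = 0 := by
      rw [hv]
      simp only [map_sum, map_smul]
      exact Finset.sum_eq_zero fun i _ => Finset.sum_eq_zero fun m _ => by
        rw [hz ⟨(t, c r), hc' r⟩ i m, smul_zero]
    rw [h4] at h3
    exact h3
  have := is_const_of_deriv_eq_zero (fun r => (hd r).differentiableAt) (fun r => (hd r).deriv) 1 0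
  rw [hf, hf]
  have c1 : c 1 = u := funext fun m => by simp [c]
  have c0 : c 0 = constJet (u 0) := funext fun m => by simp [c]
  rwa [c1, c0] at this

/-- Along a constant loop the total derivative is the time derivative. -/
lemma hasDerivAt_constJet (b : LocT W) {x : ι → ℝ} (hx : x ∈ W) (t : ℝ) :
    HasDerivAt (fun s => b.1 ⟨(s, constJet x), constJet_mem hx⟩)
      ((totalDerT W b).1 ⟨(t, constJet x), constJet_mem hx⟩) t := by
  obtain ⟨N, hN⟩ := exists_pdT_bound b
  have h := hasDerivAt_rawTD b.2 ⟨(t, constJet x), constJet_mem hx⟩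
  convert h using 1
  rw [totalDerT_eq_sum hN]
  refine (congrArg (rawTD b.1 _ + ·) ?_).trans (add_zero _)
  rw [sum_coe_apply]
  refine Finset.sum_eq_zero fun i _ => ?_
  rw [sum_coe_apply]
  exact Finset.sum_eq_zero fun m _ => zero_mul _

lemma deriv_eq_zero_of_monotone_periodic {β : ℝ → ℝ} (hm : Monotone β)
    (hp : Function.Periodic β 1) (t : ℝ) : deriv β t = 0 := by
  have hle (x y : ℝ) : β y ≤ β x := by
    obtain ⟨n, hn⟩ := exists_nat_ge (y - x)
    rw [← (by simpa using hp.nat_mul n x : β (x + n) = β x)]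
    exact hm (by linarith)
  have e : β = fun _ => β t := funext fun x => le_antisymm (hle _ _) (hle _ _)
  rw [e, deriv_const]

/-- The pairing of local functions with test functions is non-degenerate. -/
theorem eq_zero_of_cls_testFn_mul {h : LocT W} (H : ∀ ψ, cls W (testFn W ψ * h) = 0) : h = 0 := by
  obtain ⟨N, hN⟩ := exists_pdT_bound h
  have hpd (i : ι) (m : ℕ) : pdT W i m h = 0 := by
    by_cases hm : N ≤ m
    · exact hN m hm i
    refine eq_zero_of_adjoint_test (N := N) (a := fun m => pdT W i m h) (fun ψ => ?_) m
      (not_le.mp hm)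
    obtain ⟨b, hb⟩ := cls_eq_zero.mp (H ψ)
    have e (m : ℕ) : pdT W i m (testFn W ψ * h) = testFn W ψ * pdT W i m h := by
      rw [Derivation.leibniz, pdT_testFn, smul_zero, add_zero, smul_eq_mul]
    have h0 := varDer_totalDerT i b
    rw [hb, varDer_eq_sum fun m hm => by rw [e, hN m hm, mul_zero]] at h0
    simpa only [e] using h0
  refine Subtype.ext (funext fun p => ?_)
  obtain ⟨⟨t, u⟩, hu⟩ := p
  rw [apply_eq_apply_constJet hpd]
  -- Test against the restriction of `h` to the constant loop: `h ^ 2` has a periodic primitive.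
  let θ : Test := ⟨fun s => h.1 ⟨(s, constJet (u 0)), constJet_mem hu⟩, by
    obtain ⟨⟨k, F, hF, hf⟩, -⟩ := h.2
    have e : (fun s => h.1 ⟨(s, constJet (u 0)), constJet_mem hu⟩) =
      F ∘ fun s => trunc k (s, constJet (u 0)) := funext fun s => hf _
    rw [e]
    refine hF.comp_contDiff ?_ fun s => trunc_mem k ⟨(s, constJet (u 0)), constJet_mem hu⟩
    exact contDiff_id.prodMk (contDiff_const (c := fun m : Fin (k + 1) => constJet (u 0) m)),
    fun s => h.2.2 s _ _⟩
  obtain ⟨b, hb⟩ := cls_eq_zero.mp (H θ)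
  let β : ℝ → ℝ := fun s => b.1 ⟨(s, constJet (u 0)), constJet_mem hu⟩
  have hβ (s : ℝ) : HasDerivAt β (θ.1 s * θ.1 s) s := by
    have := hasDerivAt_constJet b hu s
    rw [hb] at this
    exact this
  have h0 := deriv_eq_zero_of_monotone_periodic (monotone_of_deriv_nonneg
    (fun s => (hβ s).differentiableAt) fun s => by rw [(hβ s).deriv]; exact mul_self_nonneg _)
    (fun s => b.2.2 s _ _) t
  rw [(hβ t).deriv] at h0
  exact mul_self_eq_zero.mp h0

end Separation

/-! ### The bracket of local distributions through the `λ`-bracket -/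

section Currents

variable {ι : Type*} [Fintype ι] [DecidableEq ι] {W : TopologicalSpace.Opens (ι → ℝ)}

/-- The linear map `∑ P_k λ^k ↦ ∑ P_k ∂^k φ`, which lets the formal variable `λ` act on `φ` as
the derivative. -/
def symbolEval (φ : LocT W) : (Vloc W)[X] →ₗ[ℝ] LocT W where
  toFun P := P.sum fun k a => incl W a * (totalDerT W)^[k] φ
  map_add' P Q := Polynomial.sum_add_index P Q _ (fun k => by simp) fun k a b => by
    rw [map_add, add_mul]
  map_smul' r P := by
    rw [Polynomial.sum_smul_index' P r _ (fun k => by simp), RingHom.id_apply, Polynomial.sum,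
      Polynomial.sum, Finset.smul_sum]
    exact Finset.sum_congr rfl fun k _ => by rw [map_smul, smul_mul_assoc]

lemma symbolEval_monomial (φ : LocT W) (k : ℕ) (a : Vloc W) :
    symbolEval φ (monomial k a) = incl W a * (totalDerT W)^[k] φ :=
  Polynomial.sum_monomial_index a (fun k a => incl W a * (totalDerT W)^[k] φ) (by simp)

lemma symbolEval_C (φ : LocT W) (a : Vloc W) : symbolEval φ (C a) = incl W a * φ :=
  symbolEval_monomial φ 0 a

lemma symbolEval_eq_sum (φ : LocT W) (P : (Vloc W)[X]) {N : ℕ} (hN : P.natDegree < N) :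
    symbolEval φ P = ∑ k ∈ Finset.range N, incl W (P.coeff k) * (totalDerT W)^[k] φ :=
  Polynomial.sum_over_range' P (f := fun k a => incl W a * (totalDerT W)^[k] φ) (by simp) N hN

lemma symbolEval_C_mul (φ : LocT W) (a : Vloc W) (P : (Vloc W)[X]) :
    symbolEval φ (C a * P) = incl W a * symbolEval φ P := by
  induction P using Polynomial.induction_on' with
  | add p q hp hq => rw [mul_add, map_add, map_add, hp, hq, mul_add]
  | monomial k b =>
    rw [C_mul_monomial, symbolEval_monomial, symbolEval_monomial, map_mul, mul_assoc]

/-- The operator `∂ + λ` on symbols corresponds to the total derivative. -/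
lemma symbolEval_shiftDerLin (φ : LocT W) (P : (Vloc W)[X]) :
    symbolEval φ (shiftDerLin (totalDer W) P) = totalDerT W (symbolEval φ P) := by
  induction P using Polynomial.induction_on' with
  | add p q hp hq => simp only [map_add, hp, hq]
  | monomial k b =>
    have e : shiftDerLin (totalDer W) (monomial k b) =
        monomial k (totalDer W b) + monomial (k + 1) b := by
      change shiftDer _ _ = _
      rw [shiftDer, Polynomial.sum_monomial_index _ _ (by simp), X_mul_monomial]
    rw [e, map_add, symbolEval_monomial, symbolEval_monomial, symbolEval_monomial,
      Derivation.leibniz, totalDerT_incl, Function.iterate_succ_apply', smul_eq_mul, smul_eq_mul]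
    ring

lemma symbolEval_shiftDerLin_pow (φ : LocT W) (n : ℕ) (P : (Vloc W)[X]) :
    symbolEval φ ((shiftDerLin (totalDer W) ^ n) P) =
      ((totalDerT W : LocT W →ₗ[ℝ] LocT W) ^ n) (symbolEval φ P) := by
  induction n generalizing P with
  | zero => rfl
  | succ n ih =>
    rw [pow_succ, pow_succ, Module.End.mul_apply, Module.End.mul_apply, ih,
      symbolEval_shiftDerLin]
    rfl

lemma symbolEval_neg_shiftDerLin_pow (φ : LocT W) (n : ℕ) (P : (Vloc W)[X]) :
    symbolEval φ (((-shiftDerLin (totalDer W)) ^ n) P) =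
      ((-(totalDerT W : LocT W →ₗ[ℝ] LocT W)) ^ n) (symbolEval φ P) := by
  induction n generalizing P with
  | zero => rfl
  | succ n ih =>
    rw [pow_succ, pow_succ, Module.End.mul_apply, Module.End.mul_apply, ih,
      LinearMap.neg_apply, map_neg, symbolEval_shiftDerLin]
    rfl

lemma symbolEval_applyRightLin (φ : LocT W) (Q P : (Vloc W)[X]) :
    symbolEval φ (applyRightLin Q (shiftDerLin (totalDer W)) P) =
      applyRightLin (Q.map (incl W : Vloc W →+* LocT W)) (totalDerT W : LocT W →ₗ[ℝ] LocT W)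
        (symbolEval φ P) := by
  rw [applyRightLin_apply, applyRightLin_apply, applyRight, applyRight,
    Polynomial.sum_over_range' Q (by simp) (Q.natDegree + 1) (Nat.lt_succ_self _),
    Polynomial.sum_over_range' (Q.map _) (by simp) (Q.natDegree + 1)
      (Nat.lt_succ_of_le natDegree_map_le), map_sum]
  refine Finset.sum_congr rfl fun k _ => ?_
  rw [smul_eq_C_mul, symbolEval_C_mul, ← Module.End.pow_apply, symbolEval_shiftDerLin_pow,
    Module.End.pow_apply, coeff_map]
  rfl

lemma cls_eq_mkQ (a : LocT W) :
    cls W a = (LinearMap.range (totalDerT W : LocT W →ₗ[ℝ] LocT W)).mkQ a := rfl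

lemma cls_add (a b : LocT W) : cls W (a + b) = cls W a + cls W b := rfl

lemma cls_sub (a b : LocT W) : cls W (a - b) = cls W a - cls W b := rfl

lemma cls_sum {κ : Type*} (s : Finset κ) (a : κ → LocT W) :
    cls W (∑ k ∈ s, a k) = ∑ k ∈ s, cls W (a k) := by
  simp only [cls_eq_mkQ, map_sum]

lemma cls_by_parts (n : ℕ) (a b : LocT W) :
    cls W (((-(totalDerT W : LocT W →ₗ[ℝ] LocT W)) ^ n) a * b) =
      cls W (a * ((totalDerT W : LocT W →ₗ[ℝ] LocT W) ^ n) b) := by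
  induction n generalizing b with
  | zero => rfl
  | succ n ih =>
    rw [pow_succ', pow_succ, Module.End.mul_apply, Module.End.mul_apply, ← ih, ← sub_eq_zero,
      ← cls_sub, cls_eq_zero]
    refine ⟨-(((-(totalDerT W : LocT W →ₗ[ℝ] LocT W)) ^ n) a * b), ?_⟩
    rw [map_neg, Derivation.leibniz, LinearMap.neg_apply, Derivation.coeFn_coe, smul_eq_mul,
      smul_eq_mul]
    ring

lemma pdT_incl_mul_testFn (i : ι) (m : ℕ) (f : Vloc W) (φ : Test) :
    pdT W i m (incl W f * testFn W φ) = incl W (pd W i m f) * testFn W φ := by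
  rw [Derivation.leibniz, pdT_testFn, smul_zero, zero_add, smul_eq_mul, pdT_incl, mul_comm]

/-- `{J_φ(f), J_ψ(g)} = ∫ ψ ∑ P_k ∂^k φ dt` for `{f_λ g} = ∑ P_k λ^k`: integrate by parts the
derivatives acting on `ψ`. -/
lemma currentBracket_eq (B : ι → ι → (Vloc W)[X]) (f g : Vloc W) (φ ψ : Test) :
    currentBracket B f g φ ψ = cls W (testFn W ψ * symbolEval (testFn W φ) (lam B f g)) := by
  obtain ⟨Nf, hNf⟩ := exists_pd_bound f
  obtain ⟨Ng, hNg⟩ := exists_pd_bound g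
  obtain ⟨N, hf, hg⟩ : ∃ N, (∀ m, N ≤ m → ∀ i, pd W i m f = 0) ∧
      ∀ m, N ≤ m → ∀ i, pd W i m g = 0 :=
    ⟨max Nf Ng, fun m hm => hNf m (by omega), fun m hm => hNg m (by omega)⟩
  have e (i : ι) : varDer (totalDerT W) (pdT W) i (incl W f * testFn W φ) =
      symbolEval (testFn W φ) (∑ m ∈ Finset.range N,
        ((-shiftDerLin (totalDer W)) ^ m) (C (pd W i m f))) := by
    rw [varDer_eq_sum (N := N) fun m hm => by
      rw [pdT_incl_mul_testFn, hf m hm i, map_zero, zero_mul]]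
    simp only [map_sum, symbolEval_neg_shiftDerLin_pow, symbolEval_C, pdT_incl_mul_testFn]
  have e' (j : ι) (x : LocT W) :
      cls W (varDer (totalDerT W) (pdT W) j (incl W g * testFn W ψ) * x) =
        cls W (testFn W ψ * ∑ n ∈ Finset.range N, incl W (pd W j n g) *
          ((totalDerT W : LocT W →ₗ[ℝ] LocT W) ^ n) x) := by
    rw [varDer_eq_sum (N := N) fun m hm => by
      rw [pdT_incl_mul_testFn, hg m hm j, map_zero, zero_mul], Finset.sum_mul, cls_sum,
      Finset.mul_sum, cls_sum]
    refine Finset.sum_congr rfl fun n _ => ?_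
    rw [cls_by_parts, pdT_incl_mul_testFn]
    congr 1
    ring
  have e'' (P : (LocT W)[X]) (x : LocT W) :
    applyRight P (totalDerT W) x = applyRightLin P (totalDerT W : LocT W →ₗ[ℝ] LocT W) x := rfl
  rw [currentBracket, functionalBracket, bracketDensity, lam, lambdaBr_eq_sum B hf hg, map_sum,
    Finset.mul_sum, cls_sum, cls_sum]
  refine Finset.sum_congr rfl fun i _ => ?_
  rw [map_sum, Finset.mul_sum, cls_sum, cls_sum]
  refine Finset.sum_congr rfl fun j _ => ?_
  rw [e', e, e'', ← symbolEval_applyRightLin]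
  refine congrArg (fun x => cls W (testFn W ψ * x)) ?_
  refine Eq.trans ?_ (map_sum (symbolEval (testFn W φ)) _ _).symm
  refine Finset.sum_congr rfl fun n _ => ?_
  rw [← symbolEval_shiftDerLin_pow, ← symbolEval_C_mul]
  congr 1
  simp only [map_sum, Finset.mul_sum]

/-- A symbol is determined by the local functionals `∫ ψ ∑ P_k ∂^k φ dt`. -/
lemma eq_of_cls_symbolEval {P Q : (Vloc W)[X]}
    (h : ∀ φ ψ : Test, cls W (testFn W ψ * symbolEval (testFn W φ) P) =
      cls W (testFn W ψ * symbolEval (testFn W φ) Q)) : P = Q := by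
  have hP : P.natDegree < P.natDegree + Q.natDegree + 1 := by omega
  have hQ : Q.natDegree < P.natDegree + Q.natDegree + 1 := by omega
  refine Polynomial.ext fun k => ?_
  by_cases hk : P.natDegree + Q.natDegree < k
  · rw [coeff_eq_zero_of_natDegree_lt (by omega), coeff_eq_zero_of_natDegree_lt (by omega)]
  · refine incl_injective (sub_eq_zero.mp ?_)
    refine eq_zero_of_operator_test (N := P.natDegree + Q.natDegree + 1)
      (a := fun k => incl W (P.coeff k) - incl W (Q.coeff k)) (fun φ => ?_) k (by omega)
    simp only [sub_mul, Finset.sum_sub_distrib]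
    rw [← symbolEval_eq_sum _ _ hP, ← symbolEval_eq_sum _ _ hQ]
    refine eq_zero_of_cls_testFn_mul fun ψ => ?_
    rw [mul_sub, cls_sub, h, sub_self]

/-- The right-hand side of a decomposition in terms of the generating polynomial `P`. -/
lemma J_add_schwinger (P : (Vloc W)[X]) (c : ℕ → Vloc W) (hc : ∀ j, 1 ≤ j → c j = P.coeff j)
    (φ ψ : Test) :
    J (φ * ψ) (P.coeff 0) + schwinger c φ ψ =
      cls W (testFn W ψ * symbolEval (testFn W φ) P) := by
  have hN : P.natDegree < P.natDegree + 1 + 1 := by omega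
  rw [symbolEval_eq_sum _ _ hN, Finset.mul_sum, cls_sum, Finset.sum_range_succ', add_comm]
  congr 1
  · rw [schwinger, finsum_eq_sum_range (N := P.natDegree + 1 + 1), Finset.sum_range_succ']
    · simp only [finsum_eq_if]
      rw [if_neg (by omega), add_zero]
      refine Finset.sum_congr rfl fun k _ => ?_
      rw [if_pos (by omega), hc _ (by omega), iterate_timeDer_testFn]
      congr 1
      ring
    · intro m hm
      rw [finsum_eq_if, if_pos (by omega), hc m (by omega),
        coeff_eq_zero_of_natDegree_lt (by omega), map_zero, mul_zero]
      rfl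
  · rw [J, testFn_mul]
    congr 1
    simp only [Function.iterate_zero, id]
    ring

lemma isCurrentDecomposition_lam (B : ι → ι → (Vloc W)[X]) :
    IsCurrentDecomposition B (fun f g => (lam B f g).coeff 0)
      (fun j f g => (lam B f g).coeff j) where
  finite f g := (lam B f g).support.finite_toSet.subset fun _ hj => mem_support_iff.mpr hj.2
  eq f g φ ψ := by
    rw [currentBracket_eq, J_add_schwinger _ _ fun j _ => rfl]

/-- The Dorfman bracket and the Schwinger functions are the coefficients of the `λ`-bracket. -/
lemma IsCurrentDecomposition.eq_coeff {B : ι → ι → (Vloc W)[X]} {D : Vloc W → Vloc W → Vloc W}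
    {C : ℕ → Vloc W → Vloc W → Vloc W} (h : IsCurrentDecomposition B D C) (f g : Vloc W) :
    D f g = (lam B f g).coeff 0 ∧ ∀ j, 1 ≤ j → C j f g = (lam B f g).coeff j := by
  -- The generating polynomial of `D f g, C 1 f g, C 2 f g, …`.
  obtain ⟨Q, hQ0, hQ⟩ : ∃ Q : (Vloc W)[X], Q.coeff 0 = D f g ∧
      ∀ j, 1 ≤ j → C j f g = Q.coeff j := by
    refine ⟨Polynomial.C (D f g) + ∑ j ∈ (h.finite f g).toFinset, monomial j (C j f g), ?_, ?_⟩
    · rw [coeff_add, coeff_C_zero, finsetSum_coeff, Finset.sum_eq_zero, add_zero]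
      intro j hj
      have hj : 1 ≤ j := ((h.finite f g).mem_toFinset.mp hj).1
      rw [coeff_monomial, if_neg (by omega)]
    · intro j hj
      rw [coeff_add, coeff_C, if_neg (by omega), zero_add, finsetSum_coeff]
      simp only [coeff_monomial, Finset.sum_ite_eq']
      split_ifs with hj'
      · rfl
      · by_contra h0
        exact hj' ((h.finite f g).mem_toFinset.mpr ⟨hj, h0⟩)
  have hP : lam B f g = Q := eq_of_cls_symbolEval fun φ ψ => by
    rw [← currentBracket_eq, h.eq, ← hQ0, J_add_schwinger Q _ hQ]
  rw [hP]
  exact ⟨hQ0.symm, hQ⟩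

lemma eval_zero_iterate_derivative {R : Type*} [CommRing R] [Algebra ℝ R] (P : R[X]) (j : ℕ) :
    (derivative^[j] P).eval 0 = (j.factorial : ℝ) • P.coeff j := by
  rw [← coeff_zero_eq_eval_zero, coeff_iterate_derivative, zero_add, Nat.descFactorial_self,
    Nat.cast_smul_eq_nsmul]

/-! ### The weak Courant-Dorfman structure -/

variable (W) in
/-- The map `∑ P_k λ^k ↦ ∑_{k ≥ 1} (-∂)^(k-1) P_k`. -/
def symbolTail : (Vloc W)[X] →ₗ[ℝ] Vloc W where
  toFun P := P.sum fun k a =>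
    if 1 ≤ k then ((-(totalDer W : Vloc W →ₗ[ℝ] Vloc W)) ^ (k - 1)) a else 0
  map_add' P Q := Polynomial.sum_add_index P Q _ (fun k => by simp) fun k a b => by
    split_ifs <;> simp
  map_smul' r P := by
    rw [Polynomial.sum_smul_index' P r _ (fun k => by simp), RingHom.id_apply, Polynomial.sum,
      Polynomial.sum, Finset.smul_sum]
    exact Finset.sum_congr rfl fun k _ => by split_ifs <;> simp

lemma symbolTail_eq_sum (P : (Vloc W)[X]) :
    symbolTail W P = ∑ k ∈ Finset.range (P.natDegree + 1),
      ((-(totalDer W : Vloc W →ₗ[ℝ] Vloc W)) ^ k) (P.coeff (k + 1)) := by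
  refine (Polynomial.sum_over_range' P (f := fun k a =>
    if 1 ≤ k then ((-(totalDer W : Vloc W →ₗ[ℝ] Vloc W)) ^ (k - 1)) a else 0) (by simp)
    (P.natDegree + 1 + 1) (by omega)).trans ?_
  rw [Finset.sum_range_succ']
  simp

lemma finsum_eq_symbolTail (P : (Vloc W)[X]) :
    ∑ᶠ (j : ℕ) (_ : 1 ≤ j), (fun x => -totalDer W x)^[j - 1] (P.coeff j) = symbolTail W P := by
  have e (k : ℕ) (x : Vloc W) : (fun x => -totalDer W x)^[k] x =
    ((-(totalDer W : Vloc W →ₗ[ℝ] Vloc W)) ^ k) x := neg_iterate (totalDer W : _ →ₗ[ℝ] _) k x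
  simp only [finsum_eq_if, e]
  rw [finsum_eq_sum_range (N := P.natDegree + 1)]
  · exact (Polynomial.sum_over_range' P (f := fun k a =>
      if 1 ≤ k then ((-(totalDer W : Vloc W →ₗ[ℝ] Vloc W)) ^ (k - 1)) a else 0) (by simp)
      (P.natDegree + 1) (by omega)).symm
  · intro m hm
    rw [coeff_eq_zero_of_natDegree_lt (by omega), map_zero, ite_self]

/-- Integration by parts moves all derivatives off the test function. -/
lemma cls_symbolEval (ψ : LocT W) (P : (Vloc W)[X]) :
    cls W (symbolEval ψ P) = cls W (ψ * incl W (P.coeff 0 - totalDer W (symbolTail W P))) := by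
  have e (k : ℕ) (a : Vloc W) : incl W (((-(totalDer W : Vloc W →ₗ[ℝ] Vloc W)) ^ k) a) =
      ((-(totalDerT W : LocT W →ₗ[ℝ] LocT W)) ^ k) (incl W a) := by
    induction k generalizing a with
    | zero => rfl
    | succ k ih =>
      rw [pow_succ, pow_succ, Module.End.mul_apply, Module.End.mul_apply, ih,
        LinearMap.neg_apply, LinearMap.neg_apply, map_neg]
      exact congrArg _ (congrArg _ (totalDerT_incl a).symm)
  have e' (k : ℕ) (a : Vloc W) : cls W (incl W a * (totalDerT W)^[k] ψ) =
      cls W (ψ * incl W (((-(totalDer W : Vloc W →ₗ[ℝ] Vloc W)) ^ k) a)) := by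
    rw [e, mul_comm ψ, cls_by_parts, Module.End.pow_apply]
    rfl
  have hN : P.natDegree < P.natDegree + 1 + 1 := by omega
  rw [symbolEval_eq_sum _ _ hN, cls_sum]
  simp only [e']
  rw [← cls_sum, ← Finset.mul_sum, ← map_sum, Finset.sum_range_succ', symbolTail_eq_sum, map_sum]
  simp only [pow_succ', Module.End.mul_apply, LinearMap.neg_apply, Derivation.coeFn_coe,
    Finset.sum_neg_distrib, pow_zero, Module.End.one_apply]
  rw [neg_add_eq_sub]

lemma functionalBracket_congr (B : ι → ι → (Vloc W)[X]) {a a' b b' : LocT W}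
    (ha : cls W a = cls W a') (hb : cls W b = cls W b') :
    functionalBracket B a b = functionalBracket B a' b' := by
  simp only [functionalBracket, bracketDensity, varDer_congr ha, varDer_congr hb]

/-- Bracketing with the functional `∫ f dt` is the left action of `f` by the `λ`-bracket at
`λ = 0`. -/
lemma functionalBracket_incl (B : ι → ι → (Vloc W)[X]) (f g : Vloc W) (ψ : Test) :
    functionalBracket B (incl W f) (incl W g * testFn W ψ) =
      cls W (incl W ((lam B f g).coeff 0) * testFn W ψ) := by
  have h := currentBracket_eq B f g 1 ψ
  rw [currentBracket, testFn_one, mul_one] at h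
  have e : symbolEval 1 (lam B f g) = incl W ((lam B f g).coeff 0) := by
    rw [symbolEval_eq_sum _ _ (Nat.lt_succ_self _), Finset.sum_range_succ', Finset.sum_eq_zero]
    · simp
    · intro k _
      rw [Function.iterate_succ_apply, Derivation.map_one_eq_zero, iterate_map_zero, mul_zero]
  rw [h, e, mul_comm]

lemma eq_zero_of_cls_incl_mul {h : Vloc W} (H : ∀ ψ : Test, cls W (incl W h * testFn W ψ) = 0) :
    h = 0 :=
  incl_injective (by
    rw [map_zero]
    exact eq_zero_of_cls_testFn_mul fun ψ => by rw [mul_comm]; exact H ψ)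

lemma bracketDensity_incl (B : ι → ι → (Vloc W)[X]) (f g : Vloc W) :
    cls W (bracketDensity B (incl W f) (incl W g)) = cls W (incl W ((lam B f g).coeff 0)) := by
  have h := functionalBracket_incl B f g 1
  rwa [testFn_one, mul_one, mul_one] at h

/-- The functional of a total derivative is zero, so it acts trivially. -/
lemma coeff_zero_lam_totalDer (B : ι → ι → (Vloc W)[X]) (a f : Vloc W) :
    (lam B (totalDer W a) f).coeff 0 = 0 := by
  refine eq_zero_of_cls_incl_mul fun ψ => ?_
  have e (i : ι) : varDer (totalDerT W) (pdT W) i (incl W (totalDer W a)) = 0 := by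
    rw [← totalDerT_incl, varDer_totalDerT]
  have e' (P : (LocT W)[X]) : applyRight P (totalDerT W) 0 = 0 :=
    map_zero (applyRightLin P (totalDerT W : LocT W →ₗ[ℝ] LocT W))
  rw [← functionalBracket_incl, functionalBracket, bracketDensity]
  simp only [e, e', mul_zero, Finset.sum_const_zero]
  rfl

lemma IsPoisson.coeff_zero_jacobi {B : ι → ι → (Vloc W)[X]} (hB : IsPoisson B) (f g h : Vloc W) :
    (lam B f ((lam B g h).coeff 0)).coeff 0 =
      (lam B ((lam B f g).coeff 0) h).coeff 0 + (lam B g ((lam B f h).coeff 0)).coeff 0 := by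
  rw [← sub_eq_zero]
  refine eq_zero_of_cls_incl_mul fun ψ => ?_
  have key := hB.jacobi (incl W f) (incl W g) (incl W h * testFn W ψ)
  rw [functionalBracket_congr B rfl (functionalBracket_incl B g h ψ),
    functionalBracket_congr B (bracketDensity_incl B f g) rfl,
    functionalBracket_congr B rfl (functionalBracket_incl B f h ψ),
    functionalBracket_incl, functionalBracket_incl, functionalBracket_incl] at key
  rw [map_sub, map_add, sub_mul, add_mul, cls_sub, cls_add, key, sub_self]

/-- Skew-symmetry of the bracket of `∫ f dt` and `J_ψ(g)`. -/
lemma IsPoisson.coeff_zero_add_swap {B : ι → ι → (Vloc W)[X]} (hB : IsPoisson B) (f g : Vloc W) :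
    (lam B f g).coeff 0 + (lam B g f).coeff 0 = totalDer W (symbolTail W (lam B g f)) := by
  rw [← sub_eq_zero, add_sub_assoc]
  refine eq_zero_of_cls_incl_mul fun ψ => ?_
  have key := hB.skew (incl W f) (incl W g * testFn W ψ)
  have h2 := currentBracket_eq B g f ψ 1
  rw [currentBracket, testFn_one, mul_one, one_mul, cls_symbolEval,
    mul_comm (testFn W ψ)] at h2
  rw [functionalBracket_incl, h2, ← add_eq_zero_iff_eq_neg] at key
  rw [map_add, add_mul, cls_add, key]

lemma currentPairing_eq {B : ι → ι → (Vloc W)[X]} {D : Vloc W → Vloc W → Vloc W}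
    {C : ℕ → Vloc W → Vloc W → Vloc W} (h : IsCurrentDecomposition B D C) (f g : Vloc W) :
    currentPairing C f g = (1 / 2 : ℝ) • symbolTail W (lam B f g + lam B g f) := by
  rw [currentPairing, ← finsum_eq_symbolTail]
  congr 1
  refine finsum_congr fun j => finsum_congr fun hj => ?_
  rw [(h.eq_coeff f g).2 j hj, (h.eq_coeff g f).2 j hj, coeff_add]

lemma lambdaPairing_eq (B : ι → ι → (Vloc W)[X]) (f g : Vloc W) :
    lambdaPairing B f g = (1 / 2 : ℝ) • symbolTail W (lam B f g + lam B g f) := by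
  rw [lambdaPairing, ← finsum_eq_symbolTail]
  congr 1
  refine finsum_congr fun j => finsum_congr fun hj => ?_
  have e (k : ℕ) (x : Vloc W) : (fun x => -totalDer W x)^[k] x =
    ((-(totalDer W : Vloc W →ₗ[ℝ] Vloc W)) ^ k) x := neg_iterate (totalDer W : _ →ₗ[ℝ] _) k x
  rw [eval_zero_iterate_derivative, e, e, map_smul, smul_smul, one_div,
    inv_mul_cancel₀ (by exact_mod_cast j.factorial_ne_zero), one_smul]

lemma IsPoisson.isWeakCourantDorfman {B : ι → ι → (Vloc W)[X]} (hB : IsPoisson B)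
    {D : Vloc W → Vloc W → Vloc W} {C : ℕ → Vloc W → Vloc W → Vloc W}
    (h : IsCurrentDecomposition B D C) :
    IsWeakCourantDorfman (totalDer W : Vloc W →ₗ[ℝ] Vloc W) (currentPairing C) D := by
  obtain rfl : D = fun f g => (lam B f g).coeff 0 :=
    funext fun f => funext fun g => (h.eq_coeff f g).1
  have add_l := lambdaBr_add_left (d := totalDer W) (exists_pd_bound (W := W)) B
  have add_r := lambdaBr_add_right (d := totalDer W) (exists_pd_bound (W := W)) B
  have smul_l := lambdaBr_smul_left (d := totalDer W) (exists_pd_bound (W := W)) B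
  have smul_r := lambdaBr_smul_right (d := totalDer W) (exists_pd_bound (W := W)) B
  exact
    { pair_linear := fun f => ⟨fun x y => by
          simp only [currentPairing_eq h, lam, add_l, add_r, map_add, smul_add]; abel,
        fun r x => by
          simp only [currentPairing_eq h, lam, smul_l, smul_r, map_add, map_smul, smul_add,
            smul_comm r (1 / 2 : ℝ)]⟩
      pair_symm := fun f g => by rw [currentPairing_eq h, currentPairing_eq h, add_comm]
      br_linear_left := fun g => ⟨fun x y => by simp only [lam, add_l, coeff_add],
        fun r x => by simp only [lam, smul_l, coeff_smul]⟩
      br_linear_right := fun f => ⟨fun x y => by simp only [lam, add_r, coeff_add],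
        fun r x => by simp only [lam, smul_r, coeff_smul]⟩
      jacobi := hB.coeff_zero_jacobi
      symm_part := fun f g => by
        -- Averaging the two orders symmetrizes the right-hand side.
        have h1 := hB.coeff_zero_add_swap f g
        have h2 := hB.coeff_zero_add_swap g f
        rw [currentPairing_eq h, map_smul, map_add, map_add, Derivation.coeFn_coe, ← h1, ← h2,
          add_comm ((lam B g f).coeff 0), ← two_smul ℝ, smul_smul]
        norm_num
      exact_left := fun a f => coeff_zero_lam_totalDer B a f }

end Currents

end LoopPoisson

end

open LoopPoisson
theorem proposition7p2 {ι : Type*} [Fintype ι] [DecidableEq ι]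
    (W : TopologicalSpace.Opens (ι → ℝ)) (B : ι → ι → Polynomial (Vloc W)) :
    (∃ D C, IsCurrentDecomposition B D C) ∧
    ∀ (D : Vloc W → Vloc W → Vloc W) (C : ℕ → Vloc W → Vloc W → Vloc W),
      IsCurrentDecomposition B D C →
        (∀ f g, D f g = (lam B f g).eval 0) ∧
        (∀ f g, D f g = ∑ i, ∑ j, ∑ᶠ n : ℕ, pd W j n g * (totalDer W)^[n]
          (applyRight (B i j) (totalDer W) (varDer (totalDer W) (pd W) i f))) ∧
        (∀ j, 1 ≤ j → ∀ f g, C j f g = (1 / (j.factorial : ℝ)) • jProd B j f g) ∧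
        (∀ f g, currentPairing C f g = lambdaPairing B f g) ∧
        (IsPoisson B →
          IsWeakCourantDorfman (totalDer W : Vloc W →ₗ[ℝ] Vloc W) (currentPairing C) D) := by
  refine ⟨⟨_, _, isCurrentDecomposition_lam B⟩, fun D C h => ⟨fun f g => ?_, fun f g => ?_,
    fun j hj f g => ?_, fun f g => ?_, fun hB => hB.isWeakCourantDorfman h⟩⟩
  · rw [(h.eq_coeff f g).1, Polynomial.coeff_zero_eq_eval_zero]
  · rw [(h.eq_coeff f g).1]
    exact coeff_zero_lambdaBr exists_pd_bound B f g
  · rw [(h.eq_coeff f g).2 j hj, jProd, eval_zero_iterate_derivative, smul_smul, one_div,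
      inv_mul_cancel₀ (by exact_mod_cast j.factorial_ne_zero), one_smul]
  · rw [currentPairing_eq h, lambdaPairing_eq]
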